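/- Let $p,q\ge 1$ be coprime integers with $pq$ odd, and let $K\subset S^3\subset\mathbb C^2$ be a torus knot of type $(p,q)$, that is, the image of the standard torus knot $\{\tfrac1{\sqrt2}(t^{q},t^{p}) : t\in S^1\}$ under a (possibly orientation-reversing) diffeomorphism of $S^3$. Let $$\Sigma(2,p,q)=\{(z,x,y)\in\mathbb C^3 : z^2=x^p+y^q,\ |z|^2+|x|^2+|y|^2=1\}$$ be the Brieskorn manifold, with involution $\tau(z,x,y)=(-z,x,y)$. A double cover of $S^3$ branched along $K$ is a space $Y$ with a continuous map $\pi\colon Y\to S^3$ that is a two-sheeted covering over $S^3\setminus K$, one-to-one over $K$, and of the form $(w,s)\mapsto(w^2,s)$ in charts with values in $\mathbb C\times\mathbb R$ near each point over $K$, the chart on $S^3$ carrying $K$ to $\{w=0\}$; it is smooth if $\pi$ is smooth, a local diffeomorphism off $\pi^{-1}(K)$, and the charts can be taken smooth. Its covering involution interchanges the points with equal image. Then: 1. There is a smooth double branched cover $\pi\colon\Sigma(2,p,q)\to S^3$ along $K$ whose covering involution is $\tau$. It is the double branched cover $\Sigma(K)$: for every double cover $\pi_Y\colon Y\to S^3$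 branched along $K$ there is a homeomorphism $h\colon Y\to\Sigma(2,p,q)$ with $\pi\circ h=\pi_Y$. 2. The covering involution $\tau$ of $\Sigma(2,p,q)=\Sigma(T_{p,q})$ is smoothly isotopic to the identity. More precisely, $\rho_t(z,x,y)=(t^{pq}z,\,t^{2q}x,\,t^{2p}y)$, $t\in S^1$, defines a smooth action of the circle on $\Sigma(2,p,q)$ by diffeomorphisms with $\rho_1=\mathrm{id}$ and $\rho_{-1}=\tau$, and $s\mapsto\rho_{e^{i\pi s}}$, $s\in[0,1]$, is a smooth isotopy from $\mathrm{id}$ to $\tau$. 3. For every double cover $Y\to S^3$ branched along $K$, the covering involution of $Y$ is isotopic to the identity through homeomorphisms of $Y$. -/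

import Mathlib

open scoped ContDiff

/-! ### Smooth maps between subsets of Euclidean spaces -/

section Smooth

variable {E F : Type*} [NormedAddCommGroup E] [NormedSpace ℝ E]
  [NormedAddCommGroup F] [NormedSpace ℝ F]

/-- A map between subsets of normed spaces is smooth if near every point of its domain it is
the restriction of a smooth map defined on an open set of the ambient space. -/
def IsSmoothMap {A : Set E} {B : Set F} (f : A → B) : Prop :=
  ∀ a : A, ∃ U : Set E, IsOpen U ∧ (a : E) ∈ U ∧
    ∃ g : E → F, ContDiffOn ℝ ∞ g U ∧ ∀ x : A, (x : E) ∈ U → (f x : F) = g x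

/-- A smooth bijection with smooth inverse. -/
def IsDiffeo {A : Set E} {B : Set F} (f : A → B) : Prop :=
  IsSmoothMap f ∧ ∃ g : B → A, IsSmoothMap g ∧ Function.LeftInverse g f ∧
    Function.RightInverse g f

/-- `H` is a smooth isotopy of `A` from `f` to `g`: it is smooth on `[0,1] × A`, every stage is
a diffeomorphism of `A`, and `H 0 = f`, `H 1 = g`. -/
def IsSmoothIsotopy {A : Set E} (H : ℝ → A → A) (f g : A → A) : Prop :=
  IsSmoothMap (A := Set.Icc (0 : ℝ) 1 ×ˢ A) (B := A) (fun u => H u.1.1 ⟨u.1.2, u.2.2⟩) ∧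
    (∀ s ∈ Set.Icc (0 : ℝ) 1, IsDiffeo (H s)) ∧ H 0 = f ∧ H 1 = g

/-- A chart of the subset `A` with values in `ℂ × ℝ = ℝ³` is smooth if it is a diffeomorphism
from its source (open in `A`) to its target (open in `ℂ × ℝ`). -/
def IsSmoothChart {A : Set E} (φ : OpenPartialHomeomorph A (ℂ × ℝ)) : Prop :=
  (∀ a ∈ φ.source, ∃ U : Set E, IsOpen U ∧ (a : E) ∈ U ∧
    ∃ g : E → ℂ × ℝ, ContDiffOn ℝ ∞ g U ∧ ∀ x ∈ φ.source, (x : E) ∈ U → φ x = g x) ∧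
  ContDiffOn ℝ ∞ (fun w => (φ.symm w : E)) φ.target

end Smooth

/-! ### Topological isotopy -/

/-- `f` and `g` are isotopic: there is a continuous path of homeomorphisms from `f` to `g`. -/
def IsIsotopic {Y : Type*} [TopologicalSpace Y] (f g : Y → Y) : Prop :=
  ∃ H : unitInterval × Y → Y, Continuous H ∧ (∀ s, IsHomeomorph fun y => H (s, y)) ∧
    (∀ y, H (0, y) = f y) ∧ ∀ y, H (1, y) = g y

/-! ### Torus knots in the three-sphere -/

/-- The unit sphere `S³` in `ℂ²`. -/
def sphere3 : Set (ℂ × ℂ) := {v | ‖v.1‖ ^ 2 + ‖v.2‖ ^ 2 = 1}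

/-- The standard torus knot `T_{p,q}` on the Clifford torus (for coprime `p`, `q`). -/
def standardTorusKnot (p q : ℕ) : Set sphere3 :=
  {v | ∃ t : Circle, (v : ℂ × ℂ).1 = (t : ℂ) ^ q / (Real.sqrt 2 : ℝ) ∧
    (v : ℂ × ℂ).2 = (t : ℂ) ^ p / (Real.sqrt 2 : ℝ)}

/-- `K` is a torus knot of type `(p,q)`: the image of the standard one under a diffeomorphism
of `S³`. The diffeomorphism may reverse the orientation, so mirror images are included. -/
def IsTorusKnot (p q : ℕ) (K : Set sphere3) : Prop :=
  ∃ Φ : sphere3 → sphere3, IsDiffeo Φ ∧ Φ '' standardTorusKnot p q = K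

/-! ### Double branched covers -/

/-- The local model `(w, s) ↦ (w², s)` of a double cover branched along `w = 0`. -/
def squareFold (w : ℂ × ℝ) : ℂ × ℝ := (w.1 ^ 2, w.2)

/-- In the charts `φ` around `y` and `ψ` around `π y` the map `π` is given by `g`. -/
def HasLocalForm {Y X : Type*} [TopologicalSpace Y] [TopologicalSpace X] (π : Y → X)
    (g : ℂ × ℝ → ℂ × ℝ) (φ : OpenPartialHomeomorph Y (ℂ × ℝ))
    (ψ : OpenPartialHomeomorph X (ℂ × ℝ)) (y : Y) : Prop :=
  y ∈ φ.source ∧ Set.MapsTo π φ.source ψ.source ∧ ∀ y' ∈ φ.source, ψ (π y') = g (φ y')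

/-- `ψ` is a chart that flattens `K`: inside its domain `K` is given by `w = 0`. -/
def IsFlatChart {X : Type*} [TopologicalSpace X] (K : Set X)
    (ψ : OpenPartialHomeomorph X (ℂ × ℝ)) : Prop :=
  ∀ x ∈ ψ.source, x ∈ K ↔ (ψ x).1 = 0

/-- `π : Y → S³` is a (topological) double cover of `S³` branched along `K`: a two-sheeted
covering over the complement of `K`, one-to-one over `K`, and locally modelled on
`(w, s) ↦ (w², s)` near the points over `K`. -/
structure IsDoubleBranchedCover {Y : Type*} [TopologicalSpace Y] (π : Y → sphere3)
    (K : Set sphere3) : Prop where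
  continuous : Continuous π
  covering : IsCoveringMapOn π Kᶜ
  two_sheeted : ∀ x ∉ K, (π ⁻¹' {x}).ncard = 2
  one_over_branch : ∀ x ∈ K, ∃! y, π y = x
  branched : ∀ y, π y ∈ K → ∃ φ ψ, HasLocalForm π squareFold φ ψ y ∧ IsFlatChart K ψ

/-- A smooth double cover of `S³` branched along `K`, with total space a subset `Y` of a normed
space: all charts can be chosen smooth (so `Y` is a smooth three-dimensional submanifold),
`π` is a local diffeomorphism off the branch set and is `(w, s) ↦ (w², s)` near it. -/
structure IsSmoothDoubleBranchedCover {E : Type*} [NormedAddCommGroup E] [NormedSpace ℝ E]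
    {Y : Set E} (π : Y → sphere3) (K : Set sphere3) : Prop
    extends IsDoubleBranchedCover π K where
  smooth : IsSmoothMap π
  smooth_unbranched : ∀ y, π y ∉ K → ∃ φ ψ, IsSmoothChart φ ∧ IsSmoothChart ψ ∧
    HasLocalForm π id φ ψ y
  smooth_branched : ∀ y, π y ∈ K → ∃ φ ψ, IsSmoothChart φ ∧ IsSmoothChart ψ ∧
    HasLocalForm π squareFold φ ψ y ∧ IsFlatChart K ψ

/-- `τ` is the covering involution of `π`: it interchanges the points with equal image. -/
def IsCoveringInvolution {Y X : Type*} (π : Y → X) (τ : Y → Y) : Prop :=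
  ∀ y y', π y' = π y ↔ y' = y ∨ y' = τ y

/-! ### Brieskorn manifolds -/

/-- The link `Σ(a,p,q)` of the singularity `z ^ a = x ^ p + y ^ q`, with points `(z, x, y)`. -/
def brieskorn (a p q : ℕ) : Set (ℂ × ℂ × ℂ) :=
  {v | v.1 ^ a = v.2.1 ^ p + v.2.2 ^ q ∧ ‖v.1‖ ^ 2 + ‖v.2.1‖ ^ 2 + ‖v.2.2‖ ^ 2 = 1}

/-- The involution `(z, x, y) ↦ (-z, x, y)` of `Σ(2,p,q)`. -/
def brieskornInvolution (p q : ℕ) (v : brieskorn 2 p q) : brieskorn 2 p q :=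
  ⟨(-v.1.1, v.1.2.1, v.1.2.2), by simpa [brieskorn] using v.2⟩

/-- The map `(z, x, y) ↦ (t^{pq} z, t^{2q} x, t^{2p} y)` of `Σ(2,p,q)`, for `t ∈ S¹`. -/
def brieskornRotation (p q : ℕ) (t : Circle) (v : brieskorn 2 p q) : brieskorn 2 p q :=
  ⟨((t : ℂ) ^ (p * q) * v.1.1, (t : ℂ) ^ (2 * q) * v.1.2.1, (t : ℂ) ^ (2 * p) * v.1.2.2), by
    obtain ⟨⟨z, x, y⟩, h1, h2⟩ := v
    refine ⟨?_, ?_⟩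
    · simp only at h1 ⊢
      rw [mul_pow, mul_pow, mul_pow, h1]
      ring
    · have ht : ‖(t : ℂ)‖ = 1 := t.norm_coe
      simpa [ht] using h2⟩

/-! ### Smooth maps between subsets -/

section SmoothMaps

variable {E F G : Type*} [NormedAddCommGroup E] [NormedSpace ℝ E]
  [NormedAddCommGroup F] [NormedSpace ℝ F] [NormedAddCommGroup G] [NormedSpace ℝ G]

/-! Existence. The polynomial `F = (√2 a)^p - (√2 b)^q` vanishes on `S³` exactly along the standard
torus knot and is transverse to zero there. Hence `w² = F` over `S³` (`modelCover`) is a smooth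
double branched cover with covering involution `w ↦ -w`. The surface `z² = x^p + y^q` is weighted
homogeneous, and every orbit of positive real weighted scalings through a nonzero point of it meets
the unit sphere once and the hypersurface `|x|² + |y|² = 2` once. Sliding along orbits identifies
`Σ(2,p,q)` with the second section, which is the model cover after `x = √2 a`, `y = -√2 b`; the sign
is absorbed because `q` is odd. The sliding factor depends only on absolute values, so involutions
correspond. A diffeomorphism of `S³` carries everything to an arbitrary torus knot.

Uniqueness. For a double branched cover `π`, a continuous root `W` of `F ∘ π` that separates the
sheets gives a homeomorphism `(W, π)` onto the model cover. Local roots exist: off the knot, a local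
root of `F` is multiplied by a sign labelling the sheet; at the knot, either `F` or `F` times a
flattening coordinate has a root off the knot. The first is impossible because `F` is itself a
coordinate (`not_exists_sqrt_of_chart`), and the second root divided by the coordinate upstairs is
the one sought. Local roots are unique up to a locally constant sign, and the resulting cocycle is
trivial because coverings of `S³` have sections (`exists_sign_of_cocycle`). This is
`IsDoubleBranchedCover.exists_root`, and `IsDoubleBranchedCover.exists_homeomorph_modelCover`
concludes.

Isotopy. The weights `pq, 2q, 2p` define a circle action on `Σ(2,p,q)`. Since `pq` is odd, `-1` acts
as the involution, and a half circle is the isotopy. Conjugation by the homeomorphism from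
uniqueness carries it to every other cover. -/

theorem IsSmoothMap.continuous {A : Set E} {B : Set F} {f : A → B} (hf : IsSmoothMap f) :
    Continuous f := by
  rw [continuous_iff_continuousAt]
  intro a
  obtain ⟨U, hU, haU, g, hg, hfg⟩ := hf a
  rw [Topology.IsInducing.subtypeVal.continuousAt_iff]
  have h1 : ContinuousAt (fun x : A => g x) a :=
    (hg.continuousOn.continuousAt (hU.mem_nhds haU)).comp continuous_subtype_val.continuousAt
  refine h1.congr ?_
  filter_upwards [(hU.preimage continuous_subtype_val).mem_nhds haU] with x hx
  exact (hfg x hx).symm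

theorem IsSmoothMap.comp {A : Set E} {B : Set F} {C : Set G} {g : B → C} {f : A → B}
    (hg : IsSmoothMap g) (hf : IsSmoothMap f) : IsSmoothMap (g ∘ f) := by
  intro a
  obtain ⟨U, hU, haU, f', hf', hff'⟩ := hf a
  obtain ⟨V, hV, haV, g', hg', hgg'⟩ := hg (f a)
  refine ⟨U ∩ f' ⁻¹' V, hf'.continuousOn.isOpen_inter_preimage hU hV,
    ⟨haU, by rw [Set.mem_preimage, ← hff' a haU]; exact haV⟩, g' ∘ f',
    hg'.comp (hf'.mono Set.inter_subset_left) fun x hx => hx.2, fun x hx => ?_⟩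
  have h1 := hff' x hx.1
  rw [Function.comp_apply, hgg' (f x) (by rw [h1]; exact hx.2), h1, Function.comp_apply]

/-- The restriction of a globally smooth map is smooth. -/
theorem IsSmoothMap.of_contDiff {A : Set E} {B : Set F} {f : A → B} (g : E → F)
    (hg : ContDiff ℝ ∞ g) (h : ∀ x : A, (f x : F) = g x) : IsSmoothMap f :=
  fun _ => ⟨Set.univ, isOpen_univ, trivial, g, hg.contDiffOn, fun x _ => h x⟩

/-- A homeomorphism underlying a diffeomorphism. -/
theorem IsDiffeo.exists_homeomorph {A : Set E} {B : Set F} {f : A → B} (hf : IsDiffeo f) :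
    ∃ e : A ≃ₜ B, ⇑e = f ∧ IsSmoothMap e ∧ IsSmoothMap e.symm := by
  obtain ⟨h1, g, h2, h3, h4⟩ := hf
  exact ⟨⟨⟨f, g, h3, h4⟩, h1.continuous, h2.continuous⟩, rfl, h1, h2⟩

theorem IsSmoothChart.transport {A : Set E} {B : Set F} {φ : OpenPartialHomeomorph B (ℂ × ℝ)}
    (hφ : IsSmoothChart φ) (e : A ≃ₜ B) (he : IsSmoothMap e) (he' : IsSmoothMap e.symm) :
    IsSmoothChart (e.transOpenPartialHomeomorph φ) := by
  refine ⟨fun a ha => ?_, fun w hw => ?_⟩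
  · obtain ⟨U, hU, haU, f', hf', hff'⟩ := he a
    obtain ⟨V, hV, haV, g', hg', hgg'⟩ := hφ.1 (e a) ha
    refine ⟨U ∩ f' ⁻¹' V, hf'.continuousOn.isOpen_inter_preimage hU hV,
      ⟨haU, by rw [Set.mem_preimage, ← hff' a haU]; exact haV⟩, g' ∘ f',
      hg'.comp (hf'.mono Set.inter_subset_left) fun x hx => hx.2, fun x hx hxU => ?_⟩
    have h1 := hff' x hxU.1
    have h2 := hgg' (e x) hx (by rw [h1]; exact hxU.2)
    rw [h1] at h2
    exact h2
  · have hw' : w ∈ φ.target := hw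
    obtain ⟨U, hU, haU, f', hf', hff'⟩ := he' (φ.symm w)
    have h1 := hφ.2 w hw'
    have h2 : ContDiffAt ℝ ∞ f' (φ.symm w : F) := hf'.contDiffAt (hU.mem_nhds haU)
    have h3 : ContDiffWithinAt ℝ ∞ (fun w => f' (φ.symm w : F)) φ.target w :=
      h2.comp_contDiffWithinAt w h1
    have h4 : ∀ᶠ w' in nhdsWithin w φ.target, (φ.symm w' : F) ∈ U :=
      h1.continuousWithinAt (hU.mem_nhds haU)
    refine h3.congr_of_eventuallyEq ?_ (hff' _ haU)
    filter_upwards [h4] with w' hw'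
    exact hff' _ hw'

theorem HasLocalForm.transport {Y Y' X X' : Type*} [TopologicalSpace Y] [TopologicalSpace X]
    [TopologicalSpace Y'] [TopologicalSpace X']
    {π : Y → X} {g : ℂ × ℝ → ℂ × ℝ} {φ : OpenPartialHomeomorph Y (ℂ × ℝ)}
    {ψ : OpenPartialHomeomorph X (ℂ × ℝ)} (e : Y' ≃ₜ Y) (Φ : X ≃ₜ X') {y : Y'}
    (h : HasLocalForm π g φ ψ (e y)) :
    HasLocalForm (Φ ∘ π ∘ e) g (e.transOpenPartialHomeomorph φ)
      (Φ.symm.transOpenPartialHomeomorph ψ) y := by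
  obtain ⟨h1, h2, h3⟩ := h
  refine ⟨h1, fun y' hy' => ?_, fun y' hy' => ?_⟩
  · simpa using h2 (x := e y') hy'
  · simpa using h3 (e y') hy'

theorem IsFlatChart.transport {X X' : Type*} [TopologicalSpace X] [TopologicalSpace X']
    {K : Set X} {ψ : OpenPartialHomeomorph X (ℂ × ℝ)} (h : IsFlatChart K ψ) (Φ : X ≃ₜ X') :
    IsFlatChart (Φ '' K) (Φ.symm.transOpenPartialHomeomorph ψ) := by
  intro x hx
  have := h (Φ.symm x) (by simpa using hx)
  simpa [Φ.image_eq_preimage_symm] using this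

/-- Used in both directions: to push the model cover forward to an arbitrary torus knot, and to pull
a given cover back to the standard one. -/
theorem IsDoubleBranchedCover.transport {Y Y' : Type*} [TopologicalSpace Y] [TopologicalSpace Y']
    {π : Y → sphere3} {K : Set sphere3} (h : IsDoubleBranchedCover π K) (e : Y' ≃ₜ Y)
    (Φ : sphere3 ≃ₜ sphere3) : IsDoubleBranchedCover (Φ ∘ π ∘ e) (Φ '' K) := by
  have hmem : ∀ x, x ∈ Φ '' K ↔ Φ.symm x ∈ K := fun x => by simp [Φ.image_eq_preimage_symm]
  refine ⟨Φ.continuous.comp (h.continuous.comp e.continuous), ?_, fun x hx => ?_, fun x hx => ?_,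
    fun y hy => ?_⟩
  · rw [← Set.image_compl_eq Φ.bijective, Φ.image_eq_preimage_symm]
    exact (h.covering.comp_homeomorph e).homeomorph_comp Φ
  · have h1 : (Φ ∘ π ∘ e) ⁻¹' {x} = e.symm '' (π ⁻¹' {Φ.symm x}) := by
      ext y
      rw [e.symm.image_eq_preimage_symm]
      simp [Φ.eq_symm_apply]
    rw [h1, Set.ncard_image_of_injective _ e.symm.injective]
    exact h.two_sheeted _ (by rwa [← hmem])
  · obtain ⟨y, hy, hy'⟩ := h.one_over_branch (Φ.symm x) ((hmem x).1 hx)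
    refine ⟨e.symm y, by simp [hy], fun z hz => ?_⟩
    rw [e.eq_symm_apply]
    exact hy' _ (Φ.eq_symm_apply.2 hz)
  · obtain ⟨φ, ψ, h1, h2⟩ := h.branched (e y) (by simpa using hy)
    exact ⟨_, _, h1.transport e Φ, h2.transport Φ⟩

theorem IsSmoothDoubleBranchedCover.transport {Y : Set E} {Y' : Set F}
    {π : Y → sphere3} {K : Set sphere3} (h : IsSmoothDoubleBranchedCover π K) (e : Y' ≃ₜ Y)
    (he : IsSmoothMap e) (he' : IsSmoothMap e.symm)
    (Φ : sphere3 ≃ₜ sphere3) (hΦ : IsSmoothMap Φ) (hΦ' : IsSmoothMap Φ.symm) :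
    IsSmoothDoubleBranchedCover (Φ ∘ π ∘ e) (Φ '' K) := by
  refine ⟨h.toIsDoubleBranchedCover.transport e Φ, hΦ.comp (h.smooth.comp he), fun y hy => ?_,
    fun y hy => ?_⟩
  · obtain ⟨φ, ψ, h1, h2, h3⟩ := h.smooth_unbranched (e y) (by simpa using hy)
    exact ⟨_, _, h1.transport e he he', h2.transport Φ.symm hΦ' hΦ, h3.transport e Φ⟩
  · obtain ⟨φ, ψ, h1, h2, h3, h4⟩ := h.smooth_branched (e y) (by simpa using hy)
    exact ⟨_, _, h1.transport e he he', h2.transport Φ.symm hΦ' hΦ, h3.transport e Φ,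
      h4.transport Φ⟩

/-- Near a point of the zero set `A` of `D`, a map `G` such that `(G, D)` is a local
diffeomorphism restricts to a smooth chart of `A`. -/
theorem exists_smoothChart_of_injective_fderiv {E' : Type*} [NormedAddCommGroup E']
    [NormedSpace ℝ E'] [FiniteDimensional ℝ E] [FiniteDimensional ℝ E']
    {A : Set E} {D : E → E'} (hA : ∀ x, x ∈ A ↔ D x = 0) {G : E → ℂ × ℝ}
    (hG : ContDiff ℝ ω G) (hD : ContDiff ℝ ω D)
    (hdim : Module.finrank ℝ E = Module.finrank ℝ ((ℂ × ℝ) × E')) (a : A) (G' : E →L[ℝ] ℂ × ℝ)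
    (D' : E →L[ℝ] E') (hG' : HasFDerivAt G G' a) (hD' : HasFDerivAt D D' a)
    (hinj : ∀ v, G' v = 0 → D' v = 0 → v = 0) :
    ∃ ψ : OpenPartialHomeomorph A (ℂ × ℝ), IsSmoothChart ψ ∧ a ∈ ψ.source ∧
      ∀ x : A, ψ x = G x := by
  classical
  have : CompleteSpace E := FiniteDimensional.complete ℝ E
  have hinj' : Function.Injective (G'.prod D' : E →ₗ[ℝ] (ℂ × ℝ) × E') := by
    rw [injective_iff_map_eq_zero]
    intro v hv
    have : (G' v, D' v) = 0 := hv
    exact hinj v (congrArg Prod.fst this) (congrArg Prod.snd this)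
  let L : E ≃L[ℝ] (ℂ × ℝ) × E' :=
    (LinearEquiv.ofInjectiveOfFinrankEq _ hinj' hdim).toContinuousLinearEquiv
  have hL : (L : E →L[ℝ] (ℂ × ℝ) × E') = G'.prod D' := by ext v <;> rfl
  let H : E → (ℂ × ℝ) × E' := fun x => (G x, D x)
  have hH : ContDiff ℝ ω H := hG.prodMk hD
  have hH' : HasFDerivAt H (L : E →L[ℝ] (ℂ × ℝ) × E') a := by
    rw [hL]; exact hG'.prodMk hD'
  let Ψ := hH.contDiffAt.toOpenPartialHomeomorph H hH' (by simp)
  have hΨ : ∀ x, Ψ x = H x := fun x => rfl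
  have haΨ : (a : E) ∈ Ψ.source := hH.contDiffAt.mem_toOpenPartialHomeomorph_source hH' (by simp)
  have hsymm : ContDiffAt ℝ ω Ψ.symm (Ψ a) := by
    refine Ψ.contDiffAt_symm (Ψ.map_source haΨ) (f₀' := L) ?_ ?_
    · rw [Ψ.left_inv haΨ]; exact hH'
    · exact hH.contDiffAt
  -- Order `ω` matters: being `C^ω` at a point is an open condition, whereas being `C^∞` at a point
  -- is not. On `T` the inverse is smooth at every point.
  obtain ⟨T, hT, hTo, haT⟩ := eventually_nhds_iff.1 (hsymm.eventually (by simp))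
  have hA0 : ∀ x : A, D x = 0 := fun x => (hA x).1 x.2
  let tgt : Set (ℂ × ℝ) := {c | (c, (0 : E')) ∈ Ψ.target ∩ T}
  have htgt : IsOpen tgt := (Ψ.open_target.inter hTo).preimage (by fun_prop)
  have hmem : ∀ c ∈ tgt, Ψ.symm (c, 0) ∈ A := by
    intro c hc
    rw [hA]
    have := Ψ.right_inv hc.1
    rw [hΨ] at this
    exact congrArg Prod.snd this
  let ψ : OpenPartialHomeomorph A (ℂ × ℝ) :=
    { toFun := fun x => G x
      -- The value `a` outside `tgt` is never used.
      invFun := fun c => if h : c ∈ tgt then ⟨Ψ.symm (c, 0), hmem c h⟩ else a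
      source := {x | (x : E) ∈ Ψ.source ∧ H x ∈ T}
      target := tgt
      map_source' := by
        rintro x ⟨hx, hx'⟩
        have h1 : H x = (G x, 0) := by simp [H, hA0]
        refine ⟨?_, ?_⟩
        · rw [← h1]; exact Ψ.map_source hx
        · rw [← h1]; exact hx'
      map_target' := by
        intro c hc
        simp only [hc, dif_pos]
        refine ⟨Ψ.map_target hc.1, ?_⟩
        rw [← hΨ]; dsimp only
        rw [Ψ.right_inv hc.1]; exact hc.2
      left_inv' := by
        rintro x ⟨hx, hx'⟩
        have h1 : H x = (G x, 0) := by simp [H, hA0]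
        have h2 : G x ∈ tgt := ⟨by rw [← h1]; exact Ψ.map_source hx, by rw [← h1]; exact hx'⟩
        simp only [h2, dif_pos]
        ext1
        dsimp only
        rw [← h1, ← hΨ, Ψ.left_inv hx]
      right_inv' := by
        intro c hc
        simp only [hc, dif_pos]
        have := Ψ.right_inv hc.1
        rw [hΨ] at this
        exact congrArg Prod.fst this
      open_source := (Ψ.open_source.preimage continuous_subtype_val).inter
        (hTo.preimage (hH.continuous.comp continuous_subtype_val))
      open_target := htgt
      continuousOn_toFun := (hG.continuous.comp continuous_subtype_val).continuousOn
      continuousOn_invFun := by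
        rw [Topology.IsInducing.subtypeVal.continuousOn_iff]
        have h1 : ContinuousOn (fun c : ℂ × ℝ => Ψ.symm (c, 0)) tgt :=
          Ψ.continuousOn_symm.comp (by fun_prop) fun c hc => hc.1
        refine h1.congr fun c hc => ?_
        simp [hc] }
  refine ⟨ψ, ⟨fun x _ => ⟨Set.univ, isOpen_univ, trivial, G,
    (hG.of_le (by simp)).contDiffOn, fun _ _ _ => rfl⟩, fun c hc => ?_⟩, ⟨haΨ, haT⟩, fun x => rfl⟩
  have h1 : ContDiffAt ℝ ω (fun c : ℂ × ℝ => Ψ.symm (c, 0)) c :=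
    ContDiffAt.comp c (hT _ hc.2) (by fun_prop)
  refine ((h1.of_le (by simp)).contDiffWithinAt).congr (fun c' hc' => ?_) ?_
  · change ((if h : c' ∈ tgt then _ else a : A) : E) = _
    rw [dif_pos hc']
  · change ((if h : c ∈ tgt then _ else a : A) : E) = _
    rw [dif_pos hc]

end SmoothMaps

/-! ### The polynomial of a torus knot -/

section TorusPolynomial

/-- The polynomial `(√2 a) ^ p - (√2 b) ^ q`, which cuts the standard torus knot out of `S³`. -/
noncomputable def torusPoly (p q : ℕ) (v : ℂ × ℂ) : ℂ :=
  ((Real.sqrt 2 : ℝ) * v.1) ^ p - ((Real.sqrt 2 : ℝ) * v.2) ^ q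

theorem contDiff_torusPoly (p q : ℕ) : ContDiff ℝ ω (torusPoly p q) := by
  unfold torusPoly
  fun_prop

theorem ofReal_sqrt_two_sq : ((Real.sqrt 2 : ℝ) : ℂ) ^ 2 = 2 := by
  rw [← Complex.ofReal_pow, Real.sq_sqrt (by norm_num)]; norm_num

theorem ofReal_sqrt_two_ne_zero : ((Real.sqrt 2 : ℝ) : ℂ) ≠ 0 := by
  simp

theorem norm_sqrt_two_mul_sq (a : ℂ) : ‖((Real.sqrt 2 : ℝ) : ℂ) * a‖ ^ 2 = 2 * ‖a‖ ^ 2 := by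
  rw [norm_mul, mul_pow, Complex.norm_real, Real.norm_eq_abs, sq_abs, Real.sq_sqrt (by norm_num)]

/-- With Bézout coefficients `a p + b q = 1`, the parameter is `t = x^b y^a`. -/
theorem exists_pow_eq_of_coprime {G : Type*} [CommGroup G] {p q : ℕ} (hpq : Nat.Coprime p q)
    {x y : G} (h : x ^ p = y ^ q) : ∃ t : G, x = t ^ q ∧ y = t ^ p := by
  obtain ⟨a, b, hab⟩ := Int.isCoprime_iff_gcd_eq_one.2 (by simpa using hpq :
    Int.gcd (p : ℤ) (q : ℤ) = 1)
  refine ⟨x ^ b * y ^ a, ?_, ?_⟩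
  · calc x = x ^ (a * p + b * q) := by rw [hab, zpow_one]
      _ = (x ^ p) ^ a * (x ^ b) ^ q := by
        rw [zpow_add, mul_comm a, zpow_mul, zpow_mul, zpow_natCast, zpow_natCast]
      _ = (x ^ b * y ^ a) ^ q := by
        rw [h, mul_pow, mul_comm, ← zpow_natCast y, ← zpow_natCast (y ^ a), ← zpow_mul, ← zpow_mul,
          mul_comm a]
  · calc y = y ^ (a * p + b * q) := by rw [hab, zpow_one]
      _ = (y ^ a) ^ p * (y ^ q) ^ b := by
        rw [zpow_add, mul_comm b, zpow_mul, zpow_mul, zpow_natCast, zpow_natCast]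
      _ = (x ^ b * y ^ a) ^ p := by
        rw [← h, mul_pow, mul_comm, ← zpow_natCast x, ← zpow_natCast (x ^ b), ← zpow_mul,
          ← zpow_mul, mul_comm b]

/-- Equal powers force `A` and `B` onto the same side of `1`, which the sum of squares allows only
at `1`. -/
theorem eq_one_of_pow_eq_pow {p q : ℕ} (hp : p ≠ 0) (hq : q ≠ 0) {A B : ℝ} (hA : 0 ≤ A)
    (hB : 0 ≤ B) (h : A ^ p = B ^ q) (h2 : A ^ 2 + B ^ 2 = 2) : A = 1 ∧ B = 1 := by
  have hA1 : A = 1 := by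
    rcases lt_trichotomy A 1 with h1 | h1 | h1
    · have h3 : B ^ q < 1 := h ▸ pow_lt_one₀ hA h1 hp
      have h4 : B < 1 := (pow_lt_one_iff_of_nonneg hB hq).1 h3
      nlinarith
    · exact h1
    · have h3 : 1 < B ^ q := h ▸ one_lt_pow₀ h1 hp
      have h4 : 1 < B := (one_lt_pow_iff_of_nonneg hB hq).1 h3
      nlinarith
  refine ⟨hA1, ?_⟩
  rw [hA1] at h2
  nlinarith

/-- On `S³` the zeros of the torus polynomial have both coordinates of norm `1 / √2`. -/
theorem norm_eq_one_of_torusPoly_eq_zero {p q : ℕ} (hp : p ≠ 0) (hq : q ≠ 0) {v : ℂ × ℂ}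
    (hv : v ∈ sphere3) (h : torusPoly p q v = 0) :
    ‖((Real.sqrt 2 : ℝ) : ℂ) * v.1‖ = 1 ∧ ‖((Real.sqrt 2 : ℝ) : ℂ) * v.2‖ = 1 := by
  have h1 : ‖((Real.sqrt 2 : ℝ) : ℂ) * v.1‖ ^ p = ‖((Real.sqrt 2 : ℝ) : ℂ) * v.2‖ ^ q := by
    rw [← norm_pow, ← norm_pow, sub_eq_zero.1 h]
  have h2 : ‖((Real.sqrt 2 : ℝ) : ℂ) * v.1‖ ^ 2 + ‖((Real.sqrt 2 : ℝ) : ℂ) * v.2‖ ^ 2 = 2 := by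
    rw [norm_sqrt_two_mul_sq, norm_sqrt_two_mul_sq, ← mul_add, show ‖v.1‖ ^ 2 + ‖v.2‖ ^ 2 = 1 from hv,
      mul_one]
  exact eq_one_of_pow_eq_pow hp hq (norm_nonneg _) (norm_nonneg _) h1 h2

/-- A zero of the polynomial on `S³` has both rescaled coordinates on the unit circle, where
coprimality yields the parameter. -/
theorem mem_standardTorusKnot_iff {p q : ℕ} (hpq : Nat.Coprime p q) (hp : p ≠ 0) (hq : q ≠ 0)
    (v : sphere3) : v ∈ standardTorusKnot p q ↔ torusPoly p q v = 0 := by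
  have h0 := ofReal_sqrt_two_ne_zero
  constructor
  · rintro ⟨t, h1, h2⟩
    rw [torusPoly, h1, h2, mul_div_cancel₀ _ h0, mul_div_cancel₀ _ h0, ← pow_mul, ← pow_mul,
      mul_comm, sub_self]
  · intro h
    obtain ⟨h1, h2⟩ := norm_eq_one_of_torusPoly_eq_zero hp hq v.2 h
    let X : Circle := ⟨_, mem_sphere_zero_iff_norm.2 h1⟩
    let Y : Circle := ⟨_, mem_sphere_zero_iff_norm.2 h2⟩
    have hXY : X ^ p = Y ^ q := by
      ext1
      rw [Circle.coe_pow, Circle.coe_pow]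
      exact sub_eq_zero.1 h
    obtain ⟨t, ht, ht'⟩ := exists_pow_eq_of_coprime hpq hXY
    refine ⟨t, ?_, ?_⟩
    · rw [eq_div_iff h0, ← Circle.coe_pow, ← ht, mul_comm]
    · rw [eq_div_iff h0, ← Circle.coe_pow, ← ht', mul_comm]

/-- The derivative of the torus polynomial. -/
noncomputable def torusPolyDeriv (p q : ℕ) (v : ℂ × ℂ) : ℂ × ℂ →L[ℝ] ℂ :=
  (p * ((Real.sqrt 2 : ℝ) * v.1) ^ (p - 1) * (Real.sqrt 2 : ℝ) : ℂ) • .fst ℝ ℂ ℂ -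
    (q * ((Real.sqrt 2 : ℝ) * v.2) ^ (q - 1) * (Real.sqrt 2 : ℝ) : ℂ) • .snd ℝ ℂ ℂ

theorem hasFDerivAt_torusPoly (p q : ℕ) (v : ℂ × ℂ) :
    HasFDerivAt (torusPoly p q) (torusPolyDeriv p q v) v := by
  have key : ∀ (n : ℕ) (z : ℂ), HasFDerivAt (fun z : ℂ => (((Real.sqrt 2 : ℝ) : ℂ) * z) ^ n)
      ((n * ((Real.sqrt 2 : ℝ) * z) ^ (n - 1) * (Real.sqrt 2 : ℝ) : ℂ) • .id ℝ ℂ) z := by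
    intro n z
    have h1 : HasDerivAt (fun z : ℂ => (((Real.sqrt 2 : ℝ) : ℂ) * z) ^ n)
        (n * ((Real.sqrt 2 : ℝ) * z) ^ (n - 1) * ((Real.sqrt 2 : ℝ) * 1) : ℂ) z :=
      ((hasDerivAt_id z).const_mul ((Real.sqrt 2 : ℝ) : ℂ)).pow n
    rw [mul_one] at h1
    refine (h1.hasFDerivAt.restrictScalars ℝ).congr_fderiv ?_
    ext
    all_goals simp [mul_comm]
  refine (((key p v.1).comp v hasFDerivAt_fst).sub
    ((key q v.2).comp v hasFDerivAt_snd)).congr_fderiv ?_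
  ext <;>
    simp [torusPolyDeriv]

/-- The function whose zero set is `S³`. -/
noncomputable def sphereEq (v : ℂ × ℂ) : ℝ := ‖v.1‖ ^ 2 + ‖v.2‖ ^ 2 - 1

theorem mem_sphere3_iff (v : ℂ × ℂ) : v ∈ sphere3 ↔ sphereEq v = 0 := sub_eq_zero.symm

theorem contDiff_sphereEq : ContDiff ℝ ω sphereEq :=
  ((contDiff_fst.norm_sq ℝ).add (contDiff_snd.norm_sq ℝ)).sub contDiff_const

/-- The derivative of `sphereEq`. -/
noncomputable def sphereEqDeriv (v : ℂ × ℂ) : ℂ × ℂ →L[ℝ] ℝ :=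
  2 • (innerSL ℝ v.1 ∘SL .fst ℝ ℂ ℂ) + 2 • (innerSL ℝ v.2 ∘SL .snd ℝ ℂ ℂ)

theorem hasFDerivAt_sphereEq (v : ℂ × ℂ) : HasFDerivAt sphereEq (sphereEqDeriv v) v :=
  ((hasFDerivAt_fst.norm_sq).add (hasFDerivAt_snd.norm_sq)).sub_const 1

theorem sphereEqDeriv_apply (v w : ℂ × ℂ) :
    sphereEqDeriv v w = 2 * (starRingEnd ℂ v.1 * w.1 + starRingEnd ℂ v.2 * w.2).re := by
  simp [sphereEqDeriv, Complex.inner]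
  ring

/-- Local coordinates of `S³` near `v`. -/
noncomputable def sphereCoord (v : ℂ × ℂ) : ℂ × ℂ →L[ℝ] ℂ × ℝ :=
  (v.1 • ContinuousLinearMap.snd ℝ ℂ ℂ - v.2 • ContinuousLinearMap.fst ℝ ℂ ℂ).prod
    (Complex.imCLM ∘SL (starRingEnd ℂ v.1 • ContinuousLinearMap.fst ℝ ℂ ℂ +
      starRingEnd ℂ v.2 • ContinuousLinearMap.snd ℝ ℂ ℂ))

/-- The sphere equation and the last coordinate kill the real and imaginary parts of the Hermitian
product of `v` and `w`; the determinant makes `w` a multiple of `v`. Both together force `w = 0`. -/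
theorem eq_zero_of_sphereCoord_eq_zero {v w : ℂ × ℂ} (hv : v ∈ sphere3)
    (h1 : sphereCoord v w = 0) (h2 : sphereEqDeriv v w = 0) : w = 0 := by
  rw [sphereEqDeriv_apply] at h2
  have h3 : v.1 * w.2 - v.2 * w.1 = 0 := congrArg Prod.fst h1
  have h4 : (starRingEnd ℂ v.1 * w.1 + starRingEnd ℂ v.2 * w.2).im = 0 := congrArg Prod.snd h1
  have h5 : starRingEnd ℂ v.1 * w.1 + starRingEnd ℂ v.2 * w.2 = 0 :=
    Complex.ext (by simpa using h2) h4
  have h6 : starRingEnd ℂ v.1 * v.1 + starRingEnd ℂ v.2 * v.2 = 1 := by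
    rw [Complex.conj_mul', Complex.conj_mul']
    exact_mod_cast hv
  ext1
  · simp only [Prod.fst_zero]
    linear_combination (-w.1) * h6 + v.1 * h5 - starRingEnd ℂ v.2 * h3
  · simp only [Prod.snd_zero]
    linear_combination (-w.2) * h6 + v.2 * h5 + starRingEnd ℂ v.1 * h3

/-- Local coordinates of `S³` near a point `v` of the torus knot. -/
noncomputable def knotCoord (p q : ℕ) (v x : ℂ × ℂ) : ℂ × ℝ :=
  (torusPoly p q x, (starRingEnd ℂ v.1 * x.1).im)

/-- The derivative of `knotCoord p q v` at `v`. -/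
noncomputable def knotCoordDeriv (p q : ℕ) (v : ℂ × ℂ) : ℂ × ℂ →L[ℝ] ℂ × ℝ :=
  (torusPolyDeriv p q v).prod (Complex.imCLM ∘SL (starRingEnd ℂ v.1 • ContinuousLinearMap.fst ℝ ℂ ℂ))

theorem contDiff_knotCoord (p q : ℕ) (v : ℂ × ℂ) : ContDiff ℝ ω (knotCoord p q v) :=
  (contDiff_torusPoly p q).prodMk
    ((Complex.imCLM ∘SL (starRingEnd ℂ v.1 • ContinuousLinearMap.fst ℝ ℂ ℂ) : ℂ × ℂ →L[ℝ] ℝ).contDiff)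

theorem hasFDerivAt_knotCoord (p q : ℕ) (v : ℂ × ℂ) :
    HasFDerivAt (knotCoord p q v) (knotCoordDeriv p q v) v :=
  (hasFDerivAt_torusPoly p q v).prodMk
    (Complex.imCLM ∘SL (starRingEnd ℂ v.1 • ContinuousLinearMap.fst ℝ ℂ ℂ) : ℂ × ℂ →L[ℝ] ℝ).hasFDerivAt

/-- At a knot point the kernel of `dF` is the complex line through `(qX, pY)`, with `X, Y` the
rescaled coordinates of `v`. Its imaginary multiples run along the knot and are detected by the last
coordinate; its real multiples leave the sphere. This is transversality of `F` along the knot. -/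
theorem eq_zero_of_knotCoordDeriv_eq_zero {p q : ℕ} (hp : p ≠ 0) (hq : q ≠ 0) {v w : ℂ × ℂ}
    (hv : v ∈ sphere3) (hF : torusPoly p q v = 0)
    (h1 : knotCoordDeriv p q v w = 0) (h2 : sphereEqDeriv v w = 0) : w = 0 := by
  rw [sphereEqDeriv_apply] at h2
  obtain ⟨hX, hY⟩ := norm_eq_one_of_torusPoly_eq_zero hp hq hv hF
  have h3 : torusPolyDeriv p q v w = 0 := congrArg Prod.fst h1
  have h4 : (starRingEnd ℂ v.1 * w.1).im = 0 := congrArg Prod.snd h1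
  have h0 := ofReal_sqrt_two_ne_zero
  have h02 := ofReal_sqrt_two_sq
  have hs : starRingEnd ℂ ((Real.sqrt 2 : ℝ) : ℂ) = ((Real.sqrt 2 : ℝ) : ℂ) := Complex.conj_ofReal _
  rw [torusPoly, sub_eq_zero] at hF
  simp only [torusPolyDeriv, sub_apply, smul_apply,
    ContinuousLinearMap.coe_fst', ContinuousLinearMap.coe_snd', smul_eq_mul] at h3
  have hXX : starRingEnd ℂ (((Real.sqrt 2 : ℝ) : ℂ) * v.1) * (((Real.sqrt 2 : ℝ) : ℂ) * v.1) = 1 := by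
    rw [Complex.conj_mul', hX]; norm_num
  have hYY : starRingEnd ℂ (((Real.sqrt 2 : ℝ) : ℂ) * v.2) * (((Real.sqrt 2 : ℝ) : ℂ) * v.2) = 1 := by
    rw [Complex.conj_mul', hY]; norm_num
  have hx1 : starRingEnd ℂ v.1 = starRingEnd ℂ (((Real.sqrt 2 : ℝ) : ℂ) * v.1) / (Real.sqrt 2 : ℝ) := by
    rw [map_mul, hs]; field_simp
  have hx2 : starRingEnd ℂ v.2 = starRingEnd ℂ (((Real.sqrt 2 : ℝ) : ℂ) * v.2) / (Real.sqrt 2 : ℝ) := by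
    rw [map_mul, hs]; field_simp
  rw [hx1] at h4 h2
  rw [hx2] at h2
  generalize ((Real.sqrt 2 : ℝ) : ℂ) * v.1 = X at *
  generalize ((Real.sqrt 2 : ℝ) : ℂ) * v.2 = Y at *
  have hX0 : X ≠ 0 := by rintro rfl; simp at hX
  have hY0 : Y ≠ 0 := by rintro rfl; simp at hY
  have hp0 : (p : ℂ) ≠ 0 := Nat.cast_ne_zero.2 hp
  have hq0 : (q : ℂ) ≠ 0 := Nat.cast_ne_zero.2 hq
  -- The equation `dF(w) = 0` is multiplied by `XY`, and `X^p = Y^q` is then cancelled.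
  have h5 : p * Y * w.1 = q * X * w.2 := by
    have e1 : X ^ p = X ^ (p - 1) * X := (pow_sub_one_mul hp X).symm
    have e2 : Y ^ q = Y ^ (q - 1) * Y := (pow_sub_one_mul hq Y).symm
    have h6 : X ^ p * (p * Y * w.1 - q * X * w.2) * ((Real.sqrt 2 : ℝ) : ℂ) = 0 := by
      have e3 : X ^ p * (p * Y * w.1 - q * X * w.2) =
        X ^ p * (p * Y * w.1) - Y ^ q * (q * X * w.2) := by rw [← hF]; ring
      rw [e3, e1, e2]
      linear_combination X * Y * h3
    have := (mul_eq_zero.1 ((mul_eq_zero.1 h6).resolve_right h0)).resolve_left (pow_ne_zero _ hX0)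
    exact sub_eq_zero.1 this
  obtain ⟨c, hc⟩ : ∃ c : ℂ, w.1 = q * X * c := ⟨w.1 / (q * X), by field_simp⟩
  have hc2 : w.2 = p * Y * c := by
    have : q * X * (w.2 - p * Y * c) = 0 := by rw [mul_sub, ← h5, hc]; ring
    exact sub_eq_zero.1 ((mul_eq_zero.1 this).resolve_left (mul_ne_zero hq0 hX0))
  have h7 : starRingEnd ℂ X / (Real.sqrt 2 : ℝ) * w.1 = ((q / Real.sqrt 2 : ℝ) : ℂ) * c := by
    rw [hc]; push_cast; field_simp; linear_combination c * hXX
  have h8 : starRingEnd ℂ Y / (Real.sqrt 2 : ℝ) * w.2 = ((p / Real.sqrt 2 : ℝ) : ℂ) * c := by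
    rw [hc2]; push_cast; field_simp; linear_combination c * hYY
  rw [h7, Complex.im_ofReal_mul] at h4
  rw [h7, h8, ← add_mul, ← Complex.ofReal_add, Complex.re_ofReal_mul] at h2
  have hp' : (0 : ℝ) < p := by positivity
  have hq' : (0 : ℝ) < q := by positivity
  have hc0 : c = 0 := by
    apply Complex.ext
    · have : (0 : ℝ) < q / Real.sqrt 2 + p / Real.sqrt 2 := by positivity
      simpa [this.ne'] using h2
    · have : (0 : ℝ) < q / Real.sqrt 2 := by positivity
      exact (mul_eq_zero.1 h4).resolve_left this.ne'
  ext1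
  · rw [hc, hc0, mul_zero]; rfl
  · rw [hc2, hc0, mul_zero]; rfl

end TorusPolynomial

/-! ### The double cover `w ^ 2 = F` of the three-sphere -/

section ModelCover

theorem IsSmoothChart.restrOpen {E : Type*} [NormedAddCommGroup E] [NormedSpace ℝ E] {A : Set E}
    {φ : OpenPartialHomeomorph A (ℂ × ℝ)} (hφ : IsSmoothChart φ) {s : Set A} (hs : IsOpen s) :
    IsSmoothChart (φ.restrOpen s hs) := by
  refine ⟨fun a ha => ?_, hφ.2.mono fun w hw => hw.1⟩
  rw [OpenPartialHomeomorph.restrOpen_source] at ha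
  obtain ⟨U, hU, haU, g, hg, hg'⟩ := hφ.1 a ha.1
  refine ⟨U, hU, haU, g, hg, fun x hx => hg' x ?_⟩
  rw [OpenPartialHomeomorph.restrOpen_source] at hx
  exact hx.1

theorem exists_sphereChart (v : sphere3) : ∃ ψ : OpenPartialHomeomorph sphere3 (ℂ × ℝ),
    IsSmoothChart ψ ∧ v ∈ ψ.source ∧ ∀ x : sphere3, ψ x = sphereCoord v x :=
  exists_smoothChart_of_injective_fderiv mem_sphere3_iff (sphereCoord v).contDiff
    contDiff_sphereEq (by simp) v (sphereCoord v) (sphereEqDeriv v)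
    (sphereCoord v).hasFDerivAt (hasFDerivAt_sphereEq v)
    fun _ => eq_zero_of_sphereCoord_eq_zero v.2

theorem exists_knotChart {p q : ℕ} (hp : p ≠ 0) (hq : q ≠ 0) (v : sphere3)
    (hv : torusPoly p q v = 0) : ∃ ψ : OpenPartialHomeomorph sphere3 (ℂ × ℝ),
    IsSmoothChart ψ ∧ v ∈ ψ.source ∧ ∀ x : sphere3, ψ x = knotCoord p q v x :=
  exists_smoothChart_of_injective_fderiv mem_sphere3_iff (contDiff_knotCoord p q v)
    contDiff_sphereEq (by simp) v (knotCoordDeriv p q v) (sphereEqDeriv v)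
    (hasFDerivAt_knotCoord p q v) (hasFDerivAt_sphereEq v)
    fun _ => eq_zero_of_knotCoordDeriv_eq_zero hp hq v.2 hv

/-- The surface `w ^ 2 = F(v)` over `S³`, where `F` is the polynomial of the torus knot. -/
def modelCover (p q : ℕ) : Set (ℂ × ℂ × ℂ) :=
  {u | u.2 ∈ sphere3 ∧ u.1 ^ 2 = torusPoly p q u.2}

/-- The projection of the model cover to `S³`. -/
def modelProj (p q : ℕ) (u : modelCover p q) : sphere3 := ⟨u.1.2, u.2.1⟩

/-- The function whose zero set is the model cover. -/
noncomputable def modelEq (p q : ℕ) (u : ℂ × ℂ × ℂ) : ℂ × ℝ :=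
  (u.1 ^ 2 - torusPoly p q u.2, sphereEq u.2)

theorem mem_modelCover_iff {p q : ℕ} (u : ℂ × ℂ × ℂ) : u ∈ modelCover p q ↔ modelEq p q u = 0 := by
  rw [modelEq, Prod.mk_eq_zero, sub_eq_zero, ← mem_sphere3_iff, and_comm]
  rfl

theorem contDiff_modelEq (p q : ℕ) : ContDiff ℝ ω (modelEq p q) :=
  ((contDiff_fst.pow 2).sub ((contDiff_torusPoly p q).comp contDiff_snd)).prodMk
    (contDiff_sphereEq.comp contDiff_snd)

/-- The derivative of `modelEq`. -/
noncomputable def modelEqDeriv (p q : ℕ) (u : ℂ × ℂ × ℂ) : ℂ × ℂ × ℂ →L[ℝ] ℂ × ℝ :=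
  ((2 * u.1) • ContinuousLinearMap.fst ℝ ℂ (ℂ × ℂ) -
    torusPolyDeriv p q u.2 ∘SL ContinuousLinearMap.snd ℝ ℂ (ℂ × ℂ)).prod
    (sphereEqDeriv u.2 ∘SL ContinuousLinearMap.snd ℝ ℂ (ℂ × ℂ))

theorem hasFDerivAt_modelEq (p q : ℕ) (u : ℂ × ℂ × ℂ) :
    HasFDerivAt (modelEq p q) (modelEqDeriv p q u) u := by
  have h1 : HasFDerivAt (fun z : ℂ => z ^ 2) ((2 * u.1) • ContinuousLinearMap.id ℝ ℂ) u.1 := by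
    have h2 : HasDerivAt (fun z : ℂ => z ^ 2) (2 * u.1) u.1 := by
      simpa using hasDerivAt_pow 2 u.1
    refine (h2.hasFDerivAt.restrictScalars ℝ).congr_fderiv ?_
    ext
    all_goals simp [mul_comm]
  have h3 := h1.comp u (hasFDerivAt_fst (𝕜 := ℝ) (E := ℂ) (F := ℂ × ℂ))
  exact (h3.sub ((hasFDerivAt_torusPoly p q u.2).comp u hasFDerivAt_snd)).prodMk
    ((hasFDerivAt_sphereEq u.2).comp u hasFDerivAt_snd)

theorem modelEqDeriv_eq_zero_iff {p q : ℕ} {u w : ℂ × ℂ × ℂ} : modelEqDeriv p q u w = 0 ↔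
    2 * u.1 * w.1 = torusPolyDeriv p q u.2 w.2 ∧ sphereEqDeriv u.2 w.2 = 0 := by
  rw [Prod.ext_iff]
  simp [modelEqDeriv, sub_eq_zero]

/-- Where `w ≠ 0`, the relation `2w dw = dF` determines `dw`, so coordinates of the base suffice. -/
theorem exists_modelChart {p q : ℕ} (u : modelCover p q) (hu : u.1.1 ≠ 0) :
    ∃ φ : OpenPartialHomeomorph (modelCover p q) (ℂ × ℝ), IsSmoothChart φ ∧ u ∈ φ.source ∧
      ∀ x : modelCover p q, φ x = sphereCoord u.1.2 x.1.2 := by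
  refine exists_smoothChart_of_injective_fderiv mem_modelCover_iff
    (((sphereCoord u.1.2).contDiff).comp contDiff_snd) (contDiff_modelEq p q) (by simp) u
    (sphereCoord u.1.2 ∘SL ContinuousLinearMap.snd ℝ ℂ (ℂ × ℂ)) (modelEqDeriv p q u)
    (ContinuousLinearMap.hasFDerivAt
      (sphereCoord u.1.2 ∘SL ContinuousLinearMap.snd ℝ ℂ (ℂ × ℂ)))
    (hasFDerivAt_modelEq p q u) fun w h1 h2 => ?_
  rw [modelEqDeriv_eq_zero_iff] at h2
  have h3 : w.2 = 0 := eq_zero_of_sphereCoord_eq_zero u.2.1 h1 h2.2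
  have h4 := h2.1
  rw [h3, map_zero] at h4
  exact Prod.ext ((mul_eq_zero.1 h4).resolve_left (mul_ne_zero two_ne_zero hu)) h3

/-- Where `w = 0`, the relation becomes `dF = 0`, and `w` takes over the role that `F` plays in the
knot chart below. -/
theorem exists_modelChart_branch {p q : ℕ} (hp : p ≠ 0) (hq : q ≠ 0) (u : modelCover p q)
    (hu : u.1.1 = 0) :
    ∃ φ : OpenPartialHomeomorph (modelCover p q) (ℂ × ℝ), IsSmoothChart φ ∧ u ∈ φ.source ∧
      ∀ x : modelCover p q, φ x = (x.1.1, (starRingEnd ℂ u.1.2.1 * x.1.2.1).im) := by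
  let ℓ : ℂ × ℂ →L[ℝ] ℝ :=
    Complex.imCLM ∘SL (starRingEnd ℂ u.1.2.1 • ContinuousLinearMap.fst ℝ ℂ ℂ)
  let G : ℂ × ℂ × ℂ →L[ℝ] ℂ × ℝ := (ContinuousLinearMap.fst ℝ ℂ (ℂ × ℂ)).prod
    (ℓ ∘SL ContinuousLinearMap.snd ℝ ℂ (ℂ × ℂ))
  have hF : torusPoly p q u.1.2 = 0 := by rw [← u.2.2, hu]; simp
  refine exists_smoothChart_of_injective_fderiv mem_modelCover_iff G.contDiff
    (contDiff_modelEq p q) (by simp) u G (modelEqDeriv p q u) G.hasFDerivAt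
    (hasFDerivAt_modelEq p q u) fun w h1 h2 => ?_
  rw [modelEqDeriv_eq_zero_iff, hu, mul_zero, zero_mul] at h2
  have h3 : w.1 = 0 := congrArg Prod.fst h1
  have h4 : ℓ w.2 = 0 := congrArg Prod.snd h1
  exact Prod.ext h3 (eq_zero_of_knotCoordDeriv_eq_zero hp hq u.2.1 hF
    (Prod.ext h2.1.symm h4) h2.2)

theorem continuous_torusPoly (p q : ℕ) : Continuous (torusPoly p q) :=
  (contDiff_torusPoly p q).continuous

theorem continuous_modelProj (p q : ℕ) : Continuous (modelProj p q) :=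
  (continuous_snd.comp continuous_subtype_val).subtype_mk _

theorem norm_le_one_of_mem_sphere3 {v : ℂ × ℂ} (hv : v ∈ sphere3) : ‖v‖ ≤ 1 := by
  have h : ‖v.1‖ ^ 2 + ‖v.2‖ ^ 2 = 1 := hv
  rw [Prod.norm_def, max_le_iff]
  constructor
  · nlinarith [norm_nonneg v.1, sq_nonneg ‖v.2‖]
  · nlinarith [norm_nonneg v.2, sq_nonneg ‖v.1‖]

theorem isCompact_sphere3 : IsCompact sphere3 := by
  refine Metric.isCompact_of_isClosed_isBounded ?_ ?_
  · exact isClosed_eq (by fun_prop) continuous_const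
  · exact (Metric.isBounded_closedBall (x := 0) (r := 1)).subset fun v hv => by
      simpa using norm_le_one_of_mem_sphere3 hv

theorem isCompact_modelCover (p q : ℕ) : IsCompact (modelCover p q) := by
  obtain ⟨C, hC⟩ := isCompact_sphere3.exists_bound_of_continuousOn
    (continuous_torusPoly p q).continuousOn
  refine Metric.isCompact_of_isClosed_isBounded ?_ ?_
  · exact (isCompact_sphere3.isClosed.preimage continuous_snd).inter
      (isClosed_eq (by fun_prop) ((continuous_torusPoly p q).comp continuous_snd))
  · refine (Metric.isBounded_closedBall (x := 0) (r := 1 + C)).subset fun u hu => ?_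
    have h1 := hC u.2 hu.1
    rw [← hu.2, norm_pow] at h1
    have h2 := norm_le_one_of_mem_sphere3 hu.1
    rw [mem_closedBall_zero_iff, Prod.norm_def, max_le_iff]
    constructor <;> nlinarith [norm_nonneg u.1, sq_nonneg (‖u.1‖ - 1)]

theorem fst_eq_zero_iff_modelProj_mem {p q : ℕ} (hpq : Nat.Coprime p q) (hp : p ≠ 0) (hq : q ≠ 0)
    (u : modelCover p q) : modelProj p q u ∈ standardTorusKnot p q ↔ u.1.1 = 0 := by
  rw [mem_standardTorusKnot_iff hpq hp hq, show torusPoly p q (modelProj p q u) = u.1.1 ^ 2 from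
    u.2.2.symm, sq_eq_zero_iff]

theorem modelProj_eq_iff {p q : ℕ} (u u' : modelCover p q) :
    modelProj p q u' = modelProj p q u ↔ u' = u ∨ u'.1 = (-u.1.1, u.1.2) := by
  constructor
  · intro h
    have h1 : u'.1.2 = u.1.2 := congrArg Subtype.val h
    have h2 : u'.1.1 ^ 2 = u.1.1 ^ 2 := by rw [u'.2.2, u.2.2, h1]
    rcases sq_eq_sq_iff_eq_or_eq_neg.1 h2 with h3 | h3
    · exact Or.inl (Subtype.ext (Prod.ext h3 h1))
    · exact Or.inr (Prod.ext h3 h1)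
  · rintro (rfl | h)
    · rfl
    · exact Subtype.ext (congrArg Prod.snd h : u'.1.2 = (-u.1.1, u.1.2).2)

/-- The charts above and below use matching formulas: off the knot the same `sphereCoord`, near it
`w` above and `F = w²` below, with the same real coordinate. The local forms can therefore be read
off. -/
theorem isSmoothDoubleBranchedCover_modelProj {p q : ℕ} (hpq : Nat.Coprime p q) (hp : p ≠ 0)
    (hq : q ≠ 0) : IsSmoothDoubleBranchedCover (modelProj p q) (standardTorusKnot p q) := by
  have hun : ∀ y, modelProj p q y ∉ standardTorusKnot p q → ∃ φ ψ, IsSmoothChart φ ∧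
      IsSmoothChart ψ ∧ HasLocalForm (modelProj p q) id φ ψ y := by
    intro y hy
    rw [fst_eq_zero_iff_modelProj_mem hpq hp hq] at hy
    obtain ⟨φ, hφ, hyφ, hφ'⟩ := exists_modelChart y hy
    obtain ⟨ψ, hψ, hyψ, hψ'⟩ := exists_sphereChart (modelProj p q y)
    refine ⟨φ.restrOpen _ (ψ.open_source.preimage (continuous_modelProj p q)), ψ,
      hφ.restrOpen _, hψ, ?_, ?_, fun y' _ => ?_⟩
    · rw [OpenPartialHomeomorph.restrOpen_source]
      exact ⟨hyφ, hyψ⟩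
    · intro y' hy'
      rw [OpenPartialHomeomorph.restrOpen_source] at hy'
      exact hy'.2
    · exact (hψ' _).trans (hφ' y').symm
  have hbr : ∀ y, modelProj p q y ∈ standardTorusKnot p q → ∃ φ ψ, IsSmoothChart φ ∧
      IsSmoothChart ψ ∧ HasLocalForm (modelProj p q) squareFold φ ψ y ∧
      IsFlatChart (standardTorusKnot p q) ψ := by
    intro y hy
    have hF := (mem_standardTorusKnot_iff hpq hp hq _).1 hy
    rw [fst_eq_zero_iff_modelProj_mem hpq hp hq] at hy
    obtain ⟨φ, hφ, hyφ, hφ'⟩ := exists_modelChart_branch hp hq y hy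
    obtain ⟨ψ, hψ, hyψ, hψ'⟩ := exists_knotChart hp hq (modelProj p q y) hF
    refine ⟨φ.restrOpen _ (ψ.open_source.preimage (continuous_modelProj p q)), ψ,
      hφ.restrOpen _, hψ, ⟨?_, ?_, fun y' _ => ?_⟩, fun x _ => ?_⟩
    · rw [OpenPartialHomeomorph.restrOpen_source]
      exact ⟨hyφ, hyψ⟩
    · intro y' hy'
      rw [OpenPartialHomeomorph.restrOpen_source] at hy'
      exact hy'.2
    · refine (hψ' _).trans ?_
      rw [show (φ.restrOpen _ (ψ.open_source.preimage (continuous_modelProj p q))) y' = φ y' from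
        rfl, hφ' y', squareFold]
      exact Prod.ext y'.2.2.symm rfl
    · rw [mem_standardTorusKnot_iff hpq hp hq, hψ']
      rfl
  -- Compactness upgrades the local homeomorphism over the complement of the knot to a covering
  -- there.
  have : CompactSpace (modelCover p q) := isCompact_iff_compactSpace.1 (isCompact_modelCover p q)
  refine ⟨⟨continuous_modelProj p q, ?_, fun x hx => ?_, fun x hx => ?_, fun y hy => ?_⟩,
    .of_contDiff Prod.snd contDiff_snd fun _ => rfl, hun, hbr⟩
  · refine .of_isLocalHomeomorphOn (continuous_modelProj p q) ?_
    refine IsLocalHomeomorphOn.mk _ _ fun y hy => ?_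
    obtain ⟨φ, ψ, -, -, h1, h2, h3⟩ := hun y hy
    refine ⟨φ.trans ψ.symm, ?_, fun y' hy' => ?_⟩
    · rw [OpenPartialHomeomorph.trans_source]
      refine ⟨h1, ?_⟩
      rw [Set.mem_preimage, ← id_eq (φ y), ← h3 y h1]
      exact ψ.map_source (h2 h1)
    · rw [OpenPartialHomeomorph.trans_source] at hy'
      rw [OpenPartialHomeomorph.coe_trans, Function.comp_apply, ← id_eq (φ y'), ← h3 y' hy'.1,
        ψ.left_inv (h2 hy'.1)]
  · rw [mem_standardTorusKnot_iff hpq hp hq] at hx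
    obtain ⟨w, hw⟩ := IsAlgClosed.exists_pow_nat_eq (torusPoly p q x) (n := 2) (by norm_num)
    have hw0 : w ≠ 0 := by rintro rfl; exact hx (by rw [← hw]; simp)
    let y : modelCover p q := ⟨(w, x.1), x.2, hw⟩
    let y' : modelCover p q := ⟨(-w, x.1), x.2, by simpa using hw⟩
    have h1 : modelProj p q ⁻¹' {x} = {y, y'} := by
      ext z
      rw [Set.mem_preimage, Set.mem_singleton_iff, show x = modelProj p q y from rfl,
        modelProj_eq_iff]
      rw [Set.mem_insert_iff, Set.mem_singleton_iff, Subtype.ext_iff (a1 := z) (a2 := y')]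
    rw [h1, Set.ncard_pair]
    intro h
    have : w = -w := congrArg (fun z : modelCover p q => z.1.1) h
    exact hw0 (self_eq_neg.1 this)
  · rw [mem_standardTorusKnot_iff hpq hp hq] at hx
    refine ⟨⟨(0, x.1), x.2, by rw [hx]; simp⟩, rfl, fun z hz => ?_⟩
    have h1 : z.1.2 = x.1 := congrArg Subtype.val hz
    have h2 : z.1.1 ^ 2 = 0 := by rw [z.2.2, h1, hx]
    exact Subtype.ext (Prod.ext (sq_eq_zero_iff.1 h2) h1)
  · obtain ⟨φ, ψ, -, -, h⟩ := hbr y hy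
    exact ⟨φ, ψ, h⟩

end ModelCover

/-! ### Weighted radial projection -/

section WeightedProjection

/-- The sum `c₁ t ^ l + c₂ t ^ m + c₃ t ^ n`. -/
def weightedSum (l m n : ℕ) (c : ℝ × ℝ × ℝ) (t : ℝ) : ℝ :=
  c.1 * t ^ l + c.2.1 * t ^ m + c.2.2 * t ^ n

/-- The nonzero points of the closed octant. -/
def octant : Set (ℝ × ℝ × ℝ) := {c | 0 ≤ c.1 ∧ 0 ≤ c.2.1 ∧ 0 ≤ c.2.2 ∧ 0 < c.1 + c.2.1 + c.2.2}

variable {l m n : ℕ}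

theorem weightedSum_strictMonoOn (hl : l ≠ 0) (hm : m ≠ 0) (hn : n ≠ 0) {c : ℝ × ℝ × ℝ}
    (hc : c ∈ octant) : StrictMonoOn (weightedSum l m n c) (Set.Ici 0) := by
  intro s hs t _ hst
  obtain ⟨h1, h2, h3, h4⟩ := hc
  have a1 : s ^ l < t ^ l := pow_lt_pow_left₀ hst hs hl
  have a2 : s ^ m < t ^ m := pow_lt_pow_left₀ hst hs hm
  have a3 : s ^ n < t ^ n := pow_lt_pow_left₀ hst hs hn
  have b1 := mul_le_mul_of_nonneg_left a1.le h1
  have b2 := mul_le_mul_of_nonneg_left a2.le h2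
  have b3 := mul_le_mul_of_nonneg_left a3.le h3
  unfold weightedSum
  rcases h1.lt_or_eq with h | h
  · linarith [mul_lt_mul_of_pos_left a1 h]
  rcases h2.lt_or_eq with h | h
  · linarith [mul_lt_mul_of_pos_left a2 h]
  · linarith [mul_lt_mul_of_pos_left a3 (by linarith : 0 < c.2.2)]

theorem exists_weightedSum_eq_one (hl : l ≠ 0) (hm : m ≠ 0) (hn : n ≠ 0) {c : ℝ × ℝ × ℝ}
    (hc : c ∈ octant) : ∃ t, 0 < t ∧ weightedSum l m n c t = 1 := by
  obtain ⟨h1, h2, h3, h4⟩ := hc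
  set S := c.1 + c.2.1 + c.2.2
  -- At `T = max 1 S⁻¹` every positive power of `T` is at least `T`, so the weighted sum is at least
  -- `S * T ≥ 1`.
  have hT1 : 1 ≤ max 1 S⁻¹ := le_max_left _ _
  have hT0 : 0 ≤ max 1 S⁻¹ := zero_le_one.trans hT1
  have hcont : ContinuousOn (weightedSum l m n c) (Set.Icc 0 (max 1 S⁻¹)) := by
    unfold weightedSum
    fun_prop
  have h0 : weightedSum l m n c 0 = 0 := by simp [weightedSum, hl, hm, hn]
  have hT : 1 ≤ weightedSum l m n c (max 1 S⁻¹) := by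
    have b1 := mul_le_mul_of_nonneg_left (le_self_pow₀ hT1 hl) h1
    have b2 := mul_le_mul_of_nonneg_left (le_self_pow₀ hT1 hm) h2
    have b3 := mul_le_mul_of_nonneg_left (le_self_pow₀ hT1 hn) h3
    have b4 : S * S⁻¹ ≤ S * max 1 S⁻¹ := mul_le_mul_of_nonneg_left (le_max_right _ _) h4.le
    rw [mul_inv_cancel₀ h4.ne'] at b4
    unfold weightedSum
    calc 1 ≤ S * max 1 S⁻¹ := b4
      _ = c.1 * max 1 S⁻¹ + c.2.1 * max 1 S⁻¹ + c.2.2 * max 1 S⁻¹ := by ring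
      _ ≤ _ := by linarith
  obtain ⟨t, ht, ht1⟩ := intermediate_value_Icc hT0 hcont ⟨h0.trans_le zero_le_one, hT⟩
  refine ⟨t, ht.1.lt_of_ne ?_, ht1⟩
  rintro rfl
  rw [h0] at ht1
  exact zero_ne_one ht1

/-- The positive solution `t` of `weightedSum l m n c t = 1`. -/
noncomputable def weightedScale (l m n : ℕ) (c : ℝ × ℝ × ℝ) : ℝ :=
  Classical.epsilon fun t => 0 < t ∧ weightedSum l m n c t = 1

theorem weightedScale_spec (hl : l ≠ 0) (hm : m ≠ 0) (hn : n ≠ 0) {c : ℝ × ℝ × ℝ}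
    (hc : c ∈ octant) :
    0 < weightedScale l m n c ∧ weightedSum l m n c (weightedScale l m n c) = 1 :=
  Classical.epsilon_spec (exists_weightedSum_eq_one hl hm hn hc)

theorem eq_weightedScale (hl : l ≠ 0) (hm : m ≠ 0) (hn : n ≠ 0) {c : ℝ × ℝ × ℝ}
    (hc : c ∈ octant) {t : ℝ} (ht : 0 < t) (h : weightedSum l m n c t = 1) :
    t = weightedScale l m n c := by
  obtain ⟨h1, h2⟩ := weightedScale_spec hl hm hn hc
  exact (weightedSum_strictMonoOn hl hm hn hc).injOn ht.le h1.le (h.trans h2.symm)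

theorem hasDerivAt_weightedSum (c : ℝ × ℝ × ℝ) (t : ℝ) : HasDerivAt (weightedSum l m n c)
    (c.1 * (l * t ^ (l - 1)) + c.2.1 * (m * t ^ (m - 1)) + c.2.2 * (n * t ^ (n - 1))) t :=
  (((hasDerivAt_pow l t).const_mul c.1).add ((hasDerivAt_pow m t).const_mul c.2.1)).add
    ((hasDerivAt_pow n t).const_mul c.2.2)

theorem deriv_weightedSum_pos (hl : l ≠ 0) (hm : m ≠ 0) (hn : n ≠ 0) {c : ℝ × ℝ × ℝ}
    (hc : c ∈ octant) {t : ℝ} (ht : 0 < t) :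
    0 < c.1 * (l * t ^ (l - 1)) + c.2.1 * (m * t ^ (m - 1)) + c.2.2 * (n * t ^ (n - 1)) := by
  obtain ⟨h1, h2, h3, h4⟩ := hc
  have hl' : (0 : ℝ) < l := by positivity
  have hm' : (0 : ℝ) < m := by positivity
  have hn' : (0 : ℝ) < n := by positivity
  rcases h1.lt_or_eq with h | h
  · positivity
  rcases h2.lt_or_eq with h' | h'
  · positivity
  have : 0 < c.2.2 := by linarith
  positivity

/-- The derivative in `t` is positive, so the implicit function theorem applies. The octant is not
open; the implicit function lives on a full neighbourhood and equals the scale on the octant by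
uniqueness of the positive root. -/
theorem exists_contDiffOn_weightedScale (hl : l ≠ 0) (hm : m ≠ 0) (hn : n ≠ 0) {c : ℝ × ℝ × ℝ}
    (hc : c ∈ octant) : ∃ U : Set (ℝ × ℝ × ℝ), IsOpen U ∧ c ∈ U ∧ ∃ g : ℝ × ℝ × ℝ → ℝ,
      ContDiffOn ℝ ∞ g U ∧ ∀ c' ∈ U, c' ∈ octant → g c' = weightedScale l m n c' := by
  obtain ⟨ht, ht1⟩ := weightedScale_spec hl hm hn hc
  set t := weightedScale l m n c
  let f : (ℝ × ℝ × ℝ) × ℝ → ℝ := fun u => weightedSum l m n u.1 u.2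
  have hf : ContDiff ℝ ω f := by
    unfold f weightedSum
    fun_prop
  have hfu : ContDiffAt ℝ ω f (c, t) := hf.contDiffAt
  have hd := deriv_weightedSum_pos hl hm hn hc ht
  have hinv : (fderiv ℝ f (c, t) ∘L .inr ℝ (ℝ × ℝ × ℝ) ℝ).IsInvertible := by
    refine ⟨ContinuousLinearEquiv.unitsEquivAut ℝ (Units.mk0 _ hd.ne'), ?_⟩
    have h1 : HasFDerivAt (weightedSum l m n c)
        (fderiv ℝ f (c, t) ∘L .inr ℝ (ℝ × ℝ × ℝ) ℝ) t :=
      HasFDerivAt.comp (g := f) t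
        ((hfu.differentiableAt (by simp)).hasFDerivAt) (hasFDerivAt_prodMk_right c t)
    rw [← h1.unique (hasDerivAt_weightedSum c t).hasFDerivAt |>.symm]
    ext
    simp
  let g := hfu.implicitFunction (by simp) hinv
  have hg : ContDiffAt ℝ ω g c := hfu.contDiffAt_implicitFunction (by simp) hinv
  have hgc : g c = t := hfu.implicitFunction_apply_self (by simp) hinv
  have h1 : ∀ᶠ c' in nhds c, ContDiffAt ℝ ω g c' := hg.eventually (by simp)
  have h2 : ∀ᶠ c' in nhds c, weightedSum l m n c' (g c') = 1 := by
    have := hfu.eventually_apply_implicitFunction (by simp) hinv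
    filter_upwards [this] with c' hc'
    exact hc'.trans ht1
  have h3 : ∀ᶠ c' in nhds c, 0 < g c' :=
    hg.continuousAt.eventually (by rw [hgc]; exact lt_mem_nhds ht)
  obtain ⟨U, hU, hUo, hcU⟩ := eventually_nhds_iff.1 (h1.and (h2.and h3))
  exact ⟨U, hUo, hcU, g, fun c' hc' => ((hU c' hc').1.of_le (by simp)).contDiffWithinAt,
    fun c' hc' hc'' => eq_weightedScale hl hm hn hc'' (hU c' hc').2.2 (hU c' hc').2.1⟩

/-- The part of the surface `z ^ 2 = x ^ p + y ^ q` on an ellipsoid. -/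
def surfaceSection (p q : ℕ) (α β : ℝ) : Set (ℂ × ℂ × ℂ) :=
  {v | v.1 ^ 2 = v.2.1 ^ p + v.2.2 ^ q ∧ α * ‖v.1‖ ^ 2 + β * (‖v.2.1‖ ^ 2 + ‖v.2.2‖ ^ 2) = 1}

/-- The weighted multiplication by real numbers. -/
def weightedMul (p q : ℕ) (t : ℝ) (v : ℂ × ℂ × ℂ) : ℂ × ℂ × ℂ :=
  ((t : ℂ) ^ (p * q) * v.1, (t : ℂ) ^ (2 * q) * v.2.1, (t : ℂ) ^ (2 * p) * v.2.2)

/-- The coefficients of the equation for the weighted projection to a section. -/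
noncomputable def sectionCoeff (α β : ℝ) (v : ℂ × ℂ × ℂ) : ℝ × ℝ × ℝ :=
  (α * ‖v.1‖ ^ 2, β * ‖v.2.1‖ ^ 2, β * ‖v.2.2‖ ^ 2)

variable {p q : ℕ} {α β α' β' : ℝ}

theorem weightedMul_mul (s t : ℝ) (v : ℂ × ℂ × ℂ) :
    weightedMul p q s (weightedMul p q t v) = weightedMul p q (s * t) v := by
  simp only [weightedMul, Complex.ofReal_mul, mul_pow, mul_assoc]

theorem weightedMul_one (v : ℂ × ℂ × ℂ) : weightedMul p q 1 v = v := by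
  simp [weightedMul]

theorem norm_weightedMul (t : ℝ) (v : ℂ × ℂ × ℂ) :
    α * ‖(weightedMul p q t v).1‖ ^ 2 + β * (‖(weightedMul p q t v).2.1‖ ^ 2 +
      ‖(weightedMul p q t v).2.2‖ ^ 2) =
    weightedSum (p * q * 2) (2 * q * 2) (2 * p * 2) (sectionCoeff α β v) t := by
  have e : ∀ (k : ℕ) (a : ℂ), ‖(t : ℂ) ^ k * a‖ ^ 2 = ‖a‖ ^ 2 * t ^ (k * 2) := fun k a => by
    rw [norm_mul, norm_pow, Complex.norm_real, Real.norm_eq_abs, ← abs_pow, mul_pow, sq_abs,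
      ← pow_mul, mul_comm]
  simp only [weightedMul, weightedSum, sectionCoeff, e]
  ring

/-- Weighted homogeneity preserves the surface equation, so only the ellipsoid equation is left. -/
theorem weightedMul_mem_iff {t : ℝ} {v : ℂ × ℂ × ℂ} (hv : v.1 ^ 2 = v.2.1 ^ p + v.2.2 ^ q) :
    weightedMul p q t v ∈ surfaceSection p q α β ↔
      weightedSum (p * q * 2) (2 * q * 2) (2 * p * 2) (sectionCoeff α β v) t = 1 := by
  rw [← norm_weightedMul]
  refine ⟨fun h => h.2, fun h => ⟨?_, h⟩⟩
  simp only [weightedMul, mul_pow, hv, mul_add, ← pow_mul]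
  ring_nf

/-- The weight `α'` may vanish, so positivity must come from `x` and `y`: if both are zero, the
surface equation gives `z = 0`, which is not on the ellipsoid. -/
theorem sectionCoeff_mem_octant (hp : p ≠ 0) (hq : q ≠ 0) (hα' : 0 ≤ α') (hβ' : 0 < β')
    {v : ℂ × ℂ × ℂ} (hv : v ∈ surfaceSection p q α β) : sectionCoeff α' β' v ∈ octant := by
  refine ⟨by unfold sectionCoeff; positivity, by unfold sectionCoeff; positivity,
    by unfold sectionCoeff; positivity, ?_⟩
  by_contra h
  have h0 : 0 ≤ α' * ‖v.1‖ ^ 2 := by positivity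
  have h1 : 0 ≤ β' * ‖v.2.1‖ ^ 2 := by positivity
  have h2 : 0 ≤ β' * ‖v.2.2‖ ^ 2 := by positivity
  simp only [sectionCoeff] at h
  have h3 : β' * ‖v.2.1‖ ^ 2 = 0 := by linarith
  have h4 : β' * ‖v.2.2‖ ^ 2 = 0 := by linarith
  have h5 : v.2.1 = 0 := by simpa [hβ'.ne'] using h3
  have h6 : v.2.2 = 0 := by simpa [hβ'.ne'] using h4
  have h7 := hv.1
  have h8 := hv.2
  rw [h5, h6, zero_pow hp, zero_pow hq, add_zero, sq_eq_zero_iff] at h7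
  rw [h5, h6, h7] at h8
  simp at h8

/-- The factor of the weighted projection to a section. -/
noncomputable def sectionScale (p q : ℕ) (α β : ℝ) (v : ℂ × ℂ × ℂ) : ℝ :=
  weightedScale (p * q * 2) (2 * q * 2) (2 * p * 2) (sectionCoeff α β v)

theorem sectionScale_spec (hp : p ≠ 0) (hq : q ≠ 0) (hα' : 0 ≤ α') (hβ' : 0 < β')
    {v : ℂ × ℂ × ℂ} (hv : v ∈ surfaceSection p q α β) : 0 < sectionScale p q α' β' v ∧
      weightedMul p q (sectionScale p q α' β' v) v ∈ surfaceSection p q α' β' := by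
  rw [weightedMul_mem_iff hv.1]
  exact weightedScale_spec (by positivity) (by positivity) (by positivity)
    (sectionCoeff_mem_octant hp hq hα' hβ' hv)

/-- The product and `1` both scale `v` into its original section, and such a positive factor is
unique. -/
theorem sectionScale_mul_sectionScale (hp : p ≠ 0) (hq : q ≠ 0) (hα : 0 ≤ α) (hβ : 0 < β)
    (hα' : 0 ≤ α') (hβ' : 0 < β') {v : ℂ × ℂ × ℂ} (hv : v ∈ surfaceSection p q α β) :
    sectionScale p q α β (weightedMul p q (sectionScale p q α' β' v) v) *
      sectionScale p q α' β' v = 1 := by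
  obtain ⟨h1, h2⟩ := sectionScale_spec hp hq hα' hβ' hv
  obtain ⟨h3, h4⟩ := sectionScale_spec hp hq hα hβ h2
  rw [weightedMul_mul, weightedMul_mem_iff hv.1] at h4
  have h5 := hv
  rw [← weightedMul_one (p := p) (q := q) v, weightedMul_mem_iff hv.1] at h5
  have h6 := sectionCoeff_mem_octant hp hq hα hβ hv
  rw [eq_weightedScale (by positivity) (by positivity) (by positivity) h6 (mul_pos h3 h1) h4,
    ← eq_weightedScale (by positivity) (by positivity) (by positivity) h6 one_pos h5]

/-- The weighted projection between two sections. -/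
noncomputable def sectionProj (hp : p ≠ 0) (hq : q ≠ 0) (hα' : 0 ≤ α') (hβ' : 0 < β')
    (v : surfaceSection p q α β) : surfaceSection p q α' β' :=
  ⟨_, (sectionScale_spec hp hq hα' hβ' v.2).2⟩

theorem sectionProj_sectionProj (hp : p ≠ 0) (hq : q ≠ 0) (hα : 0 ≤ α) (hβ : 0 < β)
    (hα' : 0 ≤ α') (hβ' : 0 < β') (v : surfaceSection p q α β) :
    sectionProj hp hq hα hβ (sectionProj hp hq hα' hβ' v) = v := by
  ext1
  change weightedMul p q (sectionScale p q α β (weightedMul p q (sectionScale p q α' β' v) v))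
    (weightedMul p q (sectionScale p q α' β' v) v) = v
  rw [weightedMul_mul, sectionScale_mul_sectionScale hp hq hα hβ hα' hβ' v.2, weightedMul_one]

theorem isSmoothMap_sectionProj (hp : p ≠ 0) (hq : q ≠ 0) (hα' : 0 ≤ α') (hβ' : 0 < β') :
    IsSmoothMap (sectionProj hp hq hα' hβ' :
      surfaceSection p q α β → surfaceSection p q α' β') := by
  intro v
  have hc : ∀ v : surfaceSection p q α β, sectionCoeff α' β' v ∈ octant := fun v =>
    sectionCoeff_mem_octant hp hq hα' hβ' v.2
  obtain ⟨U, hU, hvU, g, hg, hgU⟩ := exists_contDiffOn_weightedScale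
    (l := p * q * 2) (m := 2 * q * 2) (n := 2 * p * 2)
    (by positivity) (by positivity) (by positivity) (hc v)
  have hcoeff : ContDiff ℝ ∞ (sectionCoeff α' β') :=
    (contDiff_const.mul (contDiff_fst.norm_sq ℝ)).prodMk
      ((contDiff_const.mul ((contDiff_fst.comp contDiff_snd).norm_sq ℝ)).prodMk
        (contDiff_const.mul ((contDiff_snd.comp contDiff_snd).norm_sq ℝ)))
  have hmul : ContDiff ℝ ∞ (fun u : ℝ × ℂ × ℂ × ℂ => weightedMul p q u.1 u.2) := by
    have : ContDiff ℝ ∞ (fun u : ℝ × ℂ × ℂ × ℂ => (u.1 : ℂ)) :=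
      Complex.ofRealCLM.contDiff.comp contDiff_fst
    unfold weightedMul
    fun_prop
  refine ⟨sectionCoeff α' β' ⁻¹' U, hU.preimage hcoeff.continuous, hvU,
    fun v => weightedMul p q (g (sectionCoeff α' β' v)) v, ?_, fun v hv => ?_⟩
  · exact hmul.comp_contDiffOn ((hg.comp hcoeff.contDiffOn fun _ h => h).prodMk contDiffOn_id)
  · dsimp only
    rw [hgU _ hv (hc v)]
    rfl

/-- The Brieskorn manifold is diffeomorphic to the model cover, compatibly with the involutions. -/
theorem exists_diffeo_brieskorn_modelCover (hp : p ≠ 0) (hq : q ≠ 0) (hqo : Odd q) :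
    ∃ e : brieskorn 2 p q ≃ₜ modelCover p q, IsSmoothMap e ∧ IsSmoothMap e.symm ∧
      ∀ v, (e (brieskornInvolution p q v)).1 = (-(e v).1.1, (e v).1.2) := by
  have h0 := ofReal_sqrt_two_ne_zero
  -- With `α = 0`, `β = 1/2` the section is `|x|² + |y|² = 2`. The minus sign on `y` turns `x^p +
  -- y^q` into the difference in `torusPoly`, as `q` is odd.
  have hn : ∀ v : ℂ × ℂ × ℂ, v ∈ surfaceSection p q 0 (1 / 2) ↔
      (v.1, v.2.1 / (Real.sqrt 2 : ℝ), -v.2.2 / (Real.sqrt 2 : ℝ)) ∈ modelCover p q := by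
    intro v
    have e1 : ∀ a : ℂ, ‖a / (Real.sqrt 2 : ℝ)‖ ^ 2 = 1 / 2 * ‖a‖ ^ 2 := by
      intro a
      rw [norm_div, div_pow, Complex.norm_real, Real.norm_eq_abs, sq_abs,
        Real.sq_sqrt (by norm_num)]
      ring
    simp only [surfaceSection, modelCover, sphere3, torusPoly, Set.mem_ofPred_eq, e1, norm_neg,
      mul_div_cancel₀ _ h0, hqo.neg_pow, sub_neg_eq_add, zero_mul, zero_add, mul_add]
    exact and_comm
  have hb : ∀ v : ℂ × ℂ × ℂ, v ∈ brieskorn 2 p q ↔ v ∈ surfaceSection p q 1 1 := by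
    intro v
    simp [brieskorn, surfaceSection, add_assoc]
  let i : brieskorn 2 p q → surfaceSection p q 1 1 := fun v => ⟨v, (hb v).1 v.2⟩
  let i' : surfaceSection p q 1 1 → brieskorn 2 p q := fun v => ⟨v, (hb v).2 v.2⟩
  let j : surfaceSection p q 0 (1 / 2) → modelCover p q := fun v => ⟨_, (hn v).1 v.2⟩
  let j' : modelCover p q → surfaceSection p q 0 (1 / 2) := fun u =>
    ⟨(u.1.1, (Real.sqrt 2 : ℝ) * u.1.2.1, -((Real.sqrt 2 : ℝ) * u.1.2.2)), by
      rw [hn]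
      simp only [neg_neg, mul_div_cancel_left₀ _ h0]
      exact u.2⟩
  let P : surfaceSection p q 1 1 → surfaceSection p q 0 (1 / 2) :=
    sectionProj hp hq le_rfl (by norm_num)
  let P' : surfaceSection p q 0 (1 / 2) → surfaceSection p q 1 1 :=
    sectionProj hp hq zero_le_one one_pos
  have hi : IsSmoothMap i := .of_contDiff _ contDiff_id fun _ => rfl
  have hi' : IsSmoothMap i' := .of_contDiff _ contDiff_id fun _ => rfl
  have hj : IsSmoothMap j := .of_contDiff
    (fun v => (v.1, v.2.1 / (Real.sqrt 2 : ℝ), -v.2.2 / (Real.sqrt 2 : ℝ))) (by fun_prop)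
    fun _ => rfl
  have hj' : IsSmoothMap j' := .of_contDiff
    (fun u => (u.1, (Real.sqrt 2 : ℝ) * u.2.1, -((Real.sqrt 2 : ℝ) * u.2.2))) (by fun_prop)
    fun _ => rfl
  have hjj' : ∀ u, j (j' u) = u := fun u => by
    ext1
    simp only [j, j', neg_neg, mul_div_cancel_left₀ _ h0]
  have hj'j : ∀ v, j' (j v) = v := fun v => by
    ext1
    simp only [j, j', neg_neg, mul_div_cancel₀ _ h0]
  have hs : IsSmoothMap (j ∘ P ∘ i) := hj.comp ((isSmoothMap_sectionProj hp hq _ _).comp hi)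
  have hs' : IsSmoothMap (i' ∘ P' ∘ j') := hi'.comp ((isSmoothMap_sectionProj hp hq _ _).comp hj')
  let e : brieskorn 2 p q ≃ₜ modelCover p q :=
    { toFun := j ∘ P ∘ i
      invFun := i' ∘ P' ∘ j'
      left_inv := fun v => by
        simp only [Function.comp_apply, hj'j, P, P', sectionProj_sectionProj]
        rfl
      right_inv := fun u => by
        have : ∀ w, i (i' w) = w := fun _ => rfl
        simp only [Function.comp_apply, this, P, P', sectionProj_sectionProj, hjj']
      continuous_toFun := hs.continuous
      continuous_invFun := hs'.continuous }
  refine ⟨e, hs, hs', fun v => ?_⟩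
  -- The scale sees only absolute values, so it ignores the sign of `z`.
  have h1 : sectionScale p q 0 (1 / 2) (-v.1.1, v.1.2) = sectionScale p q 0 (1 / 2) v.1 := by
    simp [sectionScale, sectionCoeff]
  change (j ⟨weightedMul p q (sectionScale p q 0 (1 / 2) (-v.1.1, v.1.2)) (-v.1.1, v.1.2), _⟩).1 =
    (-(j ⟨weightedMul p q (sectionScale p q 0 (1 / 2) v.1) v.1, _⟩).1.1,
      (j ⟨weightedMul p q (sectionScale p q 0 (1 / 2) v.1) v.1, _⟩).1.2)
  simp only [h1, j, weightedMul, mul_neg]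

end WeightedProjection

/-! ### Coverings of spheres have sections -/

section CoveringSections

open Topology

/-- A surjective covering of the union of two open simply connected pieces with connected
intersection has a section. -/
theorem IsCoveringMap.exists_section_of_isOpenEmbedding {E X A B : Type*} [TopologicalSpace E]
    [TopologicalSpace X] [TopologicalSpace A] [TopologicalSpace B]
    [SimplyConnectedSpace A] [LocallyPathConnectedSpace A]
    [SimplyConnectedSpace B] [LocallyPathConnectedSpace B] {p : E → X} (hp : IsCoveringMap p)
    (hsurj : Function.Surjective p) {f : A → X} {g : B → X} (hf : IsOpenEmbedding f)
    (hg : IsOpenEmbedding g) (hU : ∀ x, x ∈ Set.range f ∨ x ∈ Set.range g)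
    (hc : IsPreconnected (Set.range f ∩ Set.range g)) (hne : (Set.range f ∩ Set.range g).Nonempty) :
    ∃ s : X → E, Continuous s ∧ ∀ x, p (s x) = x := by
  classical
  obtain ⟨x₀, ⟨a, ha⟩, ⟨b, hb⟩⟩ := hne
  obtain ⟨e₀, he₀⟩ := hsurj x₀
  -- Both pieces are lifted with the same value `e₀` over `x₀`, so the lifts agree on the connected
  -- intersection.
  obtain ⟨F, ⟨hFa, hpF⟩, -⟩ := hp.existsUnique_continuousMap_lifts ⟨f, hf.continuous⟩ a e₀
    (he₀.trans ha.symm)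
  obtain ⟨G, ⟨hGb, hpG⟩, -⟩ := hp.existsUnique_continuousMap_lifts ⟨g, hg.continuous⟩ b e₀
    (he₀.trans hb.symm)
  have : Nonempty A := ⟨a⟩
  have : Nonempty B := ⟨b⟩
  let s₁ : X → E := F ∘ Function.invFun f
  let s₂ : X → E := G ∘ Function.invFun g
  have h1 : ∀ a, s₁ (f a) = F a := fun a =>
    congrArg F (Function.leftInverse_invFun hf.injective a)
  have h2 : ∀ b, s₂ (g b) = G b := fun b =>
    congrArg G (Function.leftInverse_invFun hg.injective b)
  have c1 : ContinuousOn s₁ (Set.range f) := by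
    rintro _ ⟨a, rfl⟩
    refine ContinuousAt.continuousWithinAt (hf.continuousAt_iff.1 ?_)
    exact F.continuous.continuousAt.congr (Filter.Eventually.of_forall fun a => (h1 a).symm)
  have c2 : ContinuousOn s₂ (Set.range g) := by
    rintro _ ⟨b, rfl⟩
    refine ContinuousAt.continuousWithinAt (hg.continuousAt_iff.1 ?_)
    exact G.continuous.continuousAt.congr (Filter.Eventually.of_forall fun b => (h2 b).symm)
  have p1 : ∀ x ∈ Set.range f, p (s₁ x) = x := by
    rintro _ ⟨a, rfl⟩
    rw [h1]
    exact congrFun hpF a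
  have p2 : ∀ x ∈ Set.range g, p (s₂ x) = x := by
    rintro _ ⟨b, rfl⟩
    rw [h2]
    exact congrFun hpG b
  have heq : Set.EqOn s₁ s₂ (Set.range f ∩ Set.range g) := by
    refine hp.eqOn_of_comp_eqOn hc (c1.mono Set.inter_subset_left) (c2.mono Set.inter_subset_right)
      (fun x hx => (p1 x hx.1).trans (p2 x hx.2).symm) ⟨⟨a, ha⟩, ⟨b, hb⟩⟩ ?_
    rw [← ha, h1, hFa, ha, ← hb, h2, hGb]
  let s : X → E := fun x => if x ∈ Set.range f then s₁ x else s₂ x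
  have e1 : Set.EqOn s s₁ (Set.range f) := fun x hx => if_pos hx
  have e2 : Set.EqOn s s₂ (Set.range g) := fun x hx => by
    by_cases hxf : x ∈ Set.range f
    · rw [e1 hxf, heq ⟨hxf, hx⟩]
    · exact if_neg hxf
  refine ⟨s, continuous_iff_continuousAt.2 fun x => ?_, fun x => ?_⟩
  · rcases hU x with hx | hx
    · exact (c1.congr e1).continuousAt (hf.isOpen_range.mem_nhds hx)
    · exact (c2.congr e2).continuousAt (hg.isOpen_range.mem_nhds hx)
  · rcases hU x with hx | hx
    · rw [e1 hx, p1 x hx]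
    · rw [e2 hx, p2 x hx]

/-- Surjective coverings of spheres of dimension at least two have sections. -/
theorem IsCoveringMap.exists_section_sphere {V : Type*} [NormedAddCommGroup V]
    [InnerProductSpace ℝ V] {n : ℕ} [hV : Fact (Module.finrank ℝ V = n + 1)] (hn : 2 ≤ n)
    {E : Type*} [TopologicalSpace E] {p : E → Metric.sphere (0 : V) 1} (hp : IsCoveringMap p)
    (hsurj : Function.Surjective p) :
    ∃ s : Metric.sphere (0 : V) 1 → E, Continuous s ∧ ∀ x, p (s x) = x := by
  have : FiniteDimensional ℝ V := Module.finite_of_finrank_eq_succ hV.out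
  have : Nontrivial V := Module.nontrivial_of_finrank_pos (R := ℝ) (by rw [hV.out]; omega)
  obtain ⟨v, hv⟩ := exists_norm_eq V zero_le_one
  have hv' : ‖-v‖ = 1 := by rwa [norm_neg]
  have hf := isOpenEmbedding_stereographic_symm hv
  have hg := isOpenEmbedding_stereographic_symm hv'
  let N : Metric.sphere (0 : V) 1 := ⟨v, by simpa using hv⟩
  let S : Metric.sphere (0 : V) 1 := ⟨-v, by simpa using hv⟩
  have hNS : S ≠ N := by
    intro h
    have h1 : -v = v := congrArg Subtype.val h
    have h2 : (2 : ℝ) • v = 0 := by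
      rw [two_smul]
      nth_rewrite 1 [← h1]
      exact neg_add_cancel v
    rw [(smul_eq_zero.1 h2).resolve_left two_ne_zero, norm_zero] at hv
    exact zero_ne_one hv
  have rf : Set.range (stereographic hv).symm = {N}ᶜ := range_stereographic_symm hv
  have rg : Set.range (stereographic hv').symm = {S}ᶜ := range_stereographic_symm hv'
  obtain ⟨w, hw⟩ : S ∈ Set.range (stereographic hv).symm := by rw [rf]; exact hNS
  -- The sphere without both poles is a punctured Euclidean space of dimension `n ≥ 2`, hence
  -- connected.
  have hinter : Set.range (stereographic hv).symm ∩ Set.range (stereographic hv').symm =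
      (stereographic hv).symm '' {w}ᶜ := by
    rw [rg, ← hw, ← Set.image_singleton, Set.image_compl_eq_range_sdiff_image hf.injective]
    rfl
  have hfr : Module.finrank ℝ (ℝ ∙ v)ᗮ = n :=
    Submodule.finrank_orthogonal_span_singleton (ne_zero_of_norm_ne_zero (by rw [hv]; exact one_ne_zero))
  have hrank : 1 < Module.rank ℝ (ℝ ∙ v)ᗮ := by
    rw [← Module.finrank_eq_rank, hfr]
    exact_mod_cast hn
  have hconn : IsConnected (Set.range (stereographic hv).symm ∩
      Set.range (stereographic hv').symm) := by
    rw [hinter]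
    exact (isConnected_compl_singleton_of_one_lt_rank hrank w).image _ hf.continuous.continuousOn
  refine hp.exists_section_of_isOpenEmbedding hsurj hf hg (fun x => ?_) hconn.isPreconnected
    hconn.nonempty
  rw [rf, rg]
  by_cases hx : x = N
  · exact Or.inr fun h => hNS (h.symm.trans hx)
  · exact Or.inl hx

/-- `S³` as the unit sphere of a Euclidean space. -/
def sphere3Homeomorph : sphere3 ≃ₜ Metric.sphere (0 : WithLp 2 (ℂ × ℂ)) 1 where
  toFun v := ⟨WithLp.toLp 2 v.1, by
    have h : ‖v.1.1‖ ^ 2 + ‖v.1.2‖ ^ 2 = 1 := v.2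
    rw [mem_sphere_zero_iff_norm, ← sq_eq_sq₀ (norm_nonneg _) zero_le_one,
      WithLp.prod_norm_sq_eq_of_L2]
    simpa using h⟩
  invFun v := ⟨WithLp.ofLp v.1, by
    have h : ‖v.1‖ = 1 := mem_sphere_zero_iff_norm.1 v.2
    have h2 := WithLp.prod_norm_sq_eq_of_L2 v.1
    rw [h, one_pow] at h2
    exact h2.symm⟩
  left_inv _ := rfl
  right_inv _ := rfl
  continuous_toFun := by fun_prop
  continuous_invFun := by fun_prop

theorem IsCoveringMap.exists_section_sphere3 {E : Type*} [TopologicalSpace E] {p : E → sphere3}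
    (hp : IsCoveringMap p) (hsurj : Function.Surjective p) :
    ∃ s : sphere3 → E, Continuous s ∧ ∀ x, p (s x) = x := by
  have : Fact (Module.finrank ℝ (WithLp 2 (ℂ × ℂ)) = 3 + 1) :=
    ⟨by rw [(WithLp.linearEquiv 2 ℝ (ℂ × ℂ)).finrank_eq]; simp⟩
  obtain ⟨s, hs, hs'⟩ := (hp.homeomorph_comp sphere3Homeomorph).exists_section_sphere
    (n := 3) (by norm_num) (sphere3Homeomorph.surjective.comp hsurj)
  exact ⟨s ∘ sphere3Homeomorph, hs.comp sphere3Homeomorph.continuous,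
    fun x => sphere3Homeomorph.injective (hs' _)⟩

/-- Locally constant cocycles of signs on `S³` are coboundaries. -/
theorem exists_sign_of_cocycle {ι : Type*} (U : ι → Set sphere3) (hU : ∀ i, IsOpen (U i))
    (i₀ : sphere3 → ι) (hi₀ : ∀ x, x ∈ U (i₀ x)) (c : ι → ι → sphere3 → ℤˣ)
    (hc : ∀ i j, ContinuousOn (c i j) (U i ∩ U j))
    (hself : ∀ i, ∀ x ∈ U i, c i i x = 1)
    (hcomp : ∀ i j k, ∀ x ∈ U i ∩ U j ∩ U k, c j k x * c i j x = c i k x) :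
    ∃ s : ι → sphere3 → ℤˣ, (∀ i, ContinuousOn (s i) (U i)) ∧
      ∀ i j, ∀ x ∈ U i ∩ U j, s j x = c i j x * s i x := by
  -- The cocycle glues a two-sheeted covering of `S³`. A global section, read in the local
  -- trivialisations, is the required family of signs.
  let Z : FiberBundleCore ι sphere3 ℤˣ :=
    { baseSet := U
      isOpen_baseSet := hU
      indexAt := i₀
      mem_baseSet_at := hi₀
      coordChange := fun i j x v => c i j x * v
      coordChange_self := fun i x hx v => by rw [hself i x hx, one_mul]
      continuousOn_coordChange := fun i j =>
        ((hc i j).comp continuousOn_fst fun _ h => h.1).mul continuousOn_snd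
      coordChange_comp := fun i j k x hx v => by rw [← mul_assoc, hcomp i j k x hx] }
  have hcov : IsCoveringMap Z.proj := FiberBundle.isCoveringMap (F := ℤˣ) (E := Z.Fiber)
  obtain ⟨σ, hσ, hσ'⟩ := hcov.exists_section_sphere3 fun x => ⟨⟨x, (1 : ℤˣ)⟩, rfl⟩
  refine ⟨fun i x => (Z.localTriv i (σ x)).2, fun i => ?_, fun i j x hx => ?_⟩
  · refine continuous_snd.comp_continuousOn ((Z.localTriv i).continuousOn_toFun.comp
      hσ.continuousOn fun x hx => ?_)
    rw [Z.mem_localTriv_source]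
    change (σ x).1 ∈ U i
    rw [show (σ x).1 = x from hσ' x]
    exact hx
  · let ε : ℤˣ := (σ x).2
    have h1 : ∀ k, (Z.localTriv k (σ x)).2 = c (i₀ x) k x * ε := fun k => by
      rw [Z.localTriv_apply]
      change c (i₀ (σ x).1) k (σ x).1 * ε = _
      rw [show (σ x).1 = x from hσ' x]
    dsimp only
    rw [h1, h1, ← mul_assoc, hcomp _ _ _ x ⟨⟨hi₀ x, hx.1⟩, hx.2⟩]

end CoveringSections

/-! ### Square roots on convex sets and on punctured cylinders -/

section SquareRoots

open Topology

/-- A nonvanishing continuous function on an open convex set has a continuous square root. -/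
theorem exists_continuousOn_sqrt {E : Type*} [NormedAddCommGroup E] [NormedSpace ℝ E] {S : Set E}
    (hS : IsOpen S) (hconv : Convex ℝ S) {f : E → ℂ} (hf : ContinuousOn f S)
    (hf0 : ∀ x ∈ S, f x ≠ 0) : ∃ g : E → ℂ, ContinuousOn g S ∧ ∀ x ∈ S, g x ^ 2 = f x := by
  classical
  rcases S.eq_empty_or_nonempty with rfl | ⟨a, ha⟩
  · exact ⟨f, hf, fun x hx => hx.elim⟩
  have : ContractibleSpace S := hconv.contractibleSpace ⟨a, ha⟩
  have : SimplyConnectedSpace S := .ofContractible S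
  have : LocallyPathConnectedSpace S := hS.locallyPathConnectedSpace
  obtain ⟨w, hw⟩ := IsAlgClosed.exists_pow_nat_eq (f a) (n := 2) (by norm_num)
  -- A convex set is simply connected, so `f` lifts through the squaring map, a covering away from
  -- zero.
  obtain ⟨L, ⟨-, hL⟩, -⟩ :=
    (isCoveringMapOn_npow (𝕜 := ℂ) 2 (by norm_num)).existsUnique_continuousMap_lifts
    ⟨fun x : S => f x, hf.domRestrict⟩ (a₀ := ⟨a, ha⟩) (e₀ := w) hw fun x => hf0 x x.2
  have hg : ∀ x : S, (fun x => if h : x ∈ S then L ⟨x, h⟩ else 0) (x : E) = L x := fun x => by simp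
  refine ⟨fun x => if h : x ∈ S then L ⟨x, h⟩ else 0, ?_, fun x hx => ?_⟩
  · rw [continuousOn_iff_continuous_domRestrict]
    exact L.continuous.congr fun x => (hg x).symm
  · rw [hg ⟨x, hx⟩]
    exact congrFun hL ⟨x, hx⟩

/-- A cylinder in `ℂ × ℝ` around a vertical segment. -/
def cylinder (r₁ r₂ s : ℝ) : Set (ℂ × ℝ) := {c | ‖c.1‖ < r₁ ∧ |c.2 - s| < r₂}

/-- A cylinder with its axis removed. -/
def puncturedCylinder (r₁ r₂ s : ℝ) : Set (ℂ × ℝ) := {c | c ∈ cylinder r₁ r₂ s ∧ c.1 ≠ 0}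

theorem isOpen_cylinder (r₁ r₂ s : ℝ) : IsOpen (cylinder r₁ r₂ s) :=
  (isOpen_lt (f := fun c : ℂ × ℝ => ‖c.1‖) (by fun_prop) continuous_const).inter
    (isOpen_lt (f := fun c : ℂ × ℝ => |c.2 - s|) (by fun_prop) continuous_const)

theorem exists_cylinder_subset {N : Set (ℂ × ℝ)} {s : ℝ} (hN : N ∈ 𝓝 ((0 : ℂ), s)) :
    ∃ ρ > 0, ∀ r₁ r₂, r₁ ≤ ρ → r₂ ≤ ρ → cylinder r₁ r₂ s ⊆ N := by
  obtain ⟨ρ, hρ, h⟩ := Metric.mem_nhds_iff.1 hN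
  refine ⟨ρ, hρ, fun r₁ r₂ h1 h2 c hc => h ?_⟩
  rw [Metric.mem_ball, Prod.dist_eq, max_lt_iff, dist_zero_right, Real.dist_eq]
  exact ⟨hc.1.trans_le h1, hc.2.trans_le h2⟩

/-- The half space that covers a punctured cylinder by the exponential map. -/
def logCylinder (r₁ r₂ s : ℝ) : Set (ℂ × ℝ) := {c | c.1.re < Real.log r₁ ∧ |c.2 - s| < r₂}

theorem isOpen_logCylinder (r₁ r₂ s : ℝ) : IsOpen (logCylinder r₁ r₂ s) :=
  (isOpen_lt (f := fun c : ℂ × ℝ => c.1.re) (by fun_prop) continuous_const).inter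
    (isOpen_lt (f := fun c : ℂ × ℝ => |c.2 - s|) (by fun_prop) continuous_const)

theorem convex_logCylinder (r₁ r₂ s : ℝ) : Convex ℝ (logCylinder r₁ r₂ s) := by
  have h : logCylinder r₁ r₂ s =
      (Complex.reCLM ⁻¹' Set.Iio (Real.log r₁)) ×ˢ Metric.ball s r₂ := by
    ext c
    simp [logCylinder, Real.dist_eq]
  rw [h]
  exact ((convex_Iio _).linear_preimage Complex.reCLM.toLinearMap).prod (convex_ball s r₂)

theorem exp_mem_puncturedCylinder {r₁ r₂ s : ℝ} (hr : 0 < r₁) (c : ℂ × ℝ) :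
    (Complex.exp c.1, c.2) ∈ puncturedCylinder r₁ r₂ s ↔ c ∈ logCylinder r₁ r₂ s := by
  simp [puncturedCylinder, cylinder, logCylinder, Complex.norm_exp, Real.lt_log_iff_exp_lt hr]

theorem exists_exp_eq {c : ℂ × ℝ} (hc : c.1 ≠ 0) : ∃ d : ℂ × ℝ, (Complex.exp d.1, d.2) = c :=
  ⟨(Complex.log c.1, c.2), Prod.ext (Complex.exp_log hc) rfl⟩

/-- It is the image of a convex set under the exponential. -/
theorem isPreconnected_puncturedCylinder {r₁ : ℝ} (hr : 0 < r₁) (r₂ s : ℝ) :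
    IsPreconnected (puncturedCylinder r₁ r₂ s) := by
  have h : puncturedCylinder r₁ r₂ s =
      (fun c : ℂ × ℝ => (Complex.exp c.1, c.2)) '' logCylinder r₁ r₂ s := by
    ext c
    constructor
    · intro hc
      obtain ⟨d, rfl⟩ := exists_exp_eq hc.2
      exact ⟨d, (exp_mem_puncturedCylinder hr d).1 hc, rfl⟩
    · rintro ⟨d, hd, rfl⟩
      exact (exp_mem_puncturedCylinder hr d).2 hd
  rw [h]
  exact (convex_logCylinder _ _ _).isPreconnected.image _ (by fun_prop)

/-- A function on the half space that is invariant under the deck transformation descends. -/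
theorem exists_continuousOn_of_periodic {r₁ r₂ s : ℝ} (hr : 0 < r₁) {M : ℂ × ℝ → ℂ}
    (hM : ContinuousOn M (logCylinder r₁ r₂ s))
    (hper : ∀ c ∈ logCylinder r₁ r₂ s, M (c.1 + 2 * Real.pi * Complex.I, c.2) = M c) :
    ∃ g : ℂ × ℝ → ℂ, ContinuousOn g (puncturedCylinder r₁ r₂ s) ∧
      ∀ c ∈ logCylinder r₁ r₂ s, g (Complex.exp c.1, c.2) = M c := by
  have hmem : ∀ (z : ℂ) (t : ℝ) (k : ℤ), (z, t) ∈ logCylinder r₁ r₂ s →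
      (z + k * (2 * Real.pi * Complex.I), t) ∈ logCylinder r₁ r₂ s := by
    intro z t k h
    simpa [logCylinder] using h
  have hper' : ∀ (k : ℕ) (z : ℂ) (t : ℝ), (z, t) ∈ logCylinder r₁ r₂ s →
      M (z + k * (2 * Real.pi * Complex.I), t) = M (z, t) := by
    intro k
    induction k with
    | zero => intro z t _; simp
    | succ k ih =>
      intro z t h
      have h1 := hper _ (hmem z t k h)
      rw [Int.cast_natCast] at h1
      rw [← ih z t h, ← h1]
      push_cast
      ring_nf
  have hperZ : ∀ (k : ℤ) (z : ℂ) (t : ℝ), (z, t) ∈ logCylinder r₁ r₂ s →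
      M (z + k * (2 * Real.pi * Complex.I), t) = M (z, t) := by
    intro k z t h
    obtain ⟨n, rfl | rfl⟩ := k.eq_nat_or_neg
    · exact_mod_cast hper' n z t h
    · have := hper' n _ t (hmem z t (-n) h)
      rw [← this]
      push_cast
      ring_nf
  have key : ∀ c ∈ logCylinder r₁ r₂ s, M (Complex.log (Complex.exp c.1), c.2) = M c := by
    intro c hc
    obtain ⟨k, hk⟩ := Complex.exp_eq_exp_iff_exists_int.1
      (Complex.exp_log (Complex.exp_ne_zero c.1))
    rw [hk]
    exact hperZ k c.1 c.2 hc
  refine ⟨fun c => M (Complex.log c.1, c.2), fun c hc => ?_, key⟩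
  obtain ⟨d, rfl⟩ := exists_exp_eq hc.2
  rw [exp_mem_puncturedCylinder hr] at hc
  -- The logarithm jumps at its cut, so continuity is checked upstairs and pushed down through the
  -- open exponential map.
  have hopen : IsOpenMap (fun c : ℂ × ℝ => (Complex.exp c.1, c.2)) :=
    Complex.isOpenMap_exp.prodMap IsOpenMap.id
  refine ContinuousAt.continuousWithinAt ?_
  have h1 : ContinuousAt ((fun c : ℂ × ℝ => M (Complex.log c.1, c.2)) ∘
      fun c : ℂ × ℝ => (Complex.exp c.1, c.2)) d := by
    refine (hM.continuousAt ((isOpen_logCylinder _ _ _).mem_nhds hc)).congr ?_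
    filter_upwards [(isOpen_logCylinder _ _ _).mem_nhds hc] with c hc
    exact (key c hc).symm
  exact (Filter.tendsto_map'_iff.2 h1).mono_left (hopen.nhds_le d)

/-- For a nonvanishing function `f` on a punctured cylinder, either `f` or `f` times the complex
coordinate has a continuous square root. -/
theorem exists_sqrt_puncturedCylinder {r₁ r₂ s : ℝ} (hr : 0 < r₁) {f : ℂ × ℝ → ℂ}
    (hf : ContinuousOn f (puncturedCylinder r₁ r₂ s))
    (hf0 : ∀ c ∈ puncturedCylinder r₁ r₂ s, f c ≠ 0) :
    ∃ g : ℂ × ℝ → ℂ, ContinuousOn g (puncturedCylinder r₁ r₂ s) ∧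
      ((∀ c ∈ puncturedCylinder r₁ r₂ s, g c ^ 2 = f c) ∨
        ∀ c ∈ puncturedCylinder r₁ r₂ s, g c ^ 2 = c.1 * f c) := by
  have hexp : ∀ c, c ∈ logCylinder r₁ r₂ s → (Complex.exp c.1, c.2) ∈ puncturedCylinder r₁ r₂ s :=
    fun c => (exp_mem_puncturedCylinder hr c).2
  obtain ⟨L, hL, hL2⟩ := exists_continuousOn_sqrt (isOpen_logCylinder r₁ r₂ s)
    (convex_logCylinder r₁ r₂ s) (f := fun c => f (Complex.exp c.1, c.2))
    (hf.comp (by fun_prop) hexp) fun c hc => hf0 _ (hexp c hc)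
  have hL0 : ∀ c ∈ logCylinder r₁ r₂ s, L c ≠ 0 := fun c hc h =>
    hf0 _ (hexp c hc) (by rw [← hL2 c hc, h]; simp)
  have hT : ∀ c ∈ logCylinder r₁ r₂ s,
      (c.1 + 2 * Real.pi * Complex.I, c.2) ∈ logCylinder r₁ r₂ s := by
    intro c hc
    simpa [logCylinder] using hc
  -- The translate of `L` by the period is another root of the same function, so it is `L` or `-L`
  -- throughout.
  rcases (convex_logCylinder r₁ r₂ s).isPreconnected.eq_or_eq_neg_of_sq_eq
    (f := fun c => L (c.1 + 2 * Real.pi * Complex.I, c.2)) (g := L)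
    (hL.comp (f := fun c : ℂ × ℝ => (c.1 + 2 * Real.pi * Complex.I, c.2)) (by fun_prop) hT) hL (fun c hc => by
      simp only [Pi.pow_apply]
      rw [hL2 _ (hT c hc), hL2 c hc, Complex.exp_add, Complex.exp_two_pi_mul_I, mul_one])
    (fun {c} hc => hL0 c hc) with h | h
  · obtain ⟨g, hg, hgM⟩ := exists_continuousOn_of_periodic hr hL h
    refine ⟨g, hg, Or.inl fun c hc => ?_⟩
    obtain ⟨d, rfl⟩ := exists_exp_eq hc.2
    rw [exp_mem_puncturedCylinder hr] at hc
    rw [hgM d hc, hL2 d hc]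
  -- When `L` changes sign, so does `exp (c.1 / 2)`, a root of the complex coordinate; their product
  -- is periodic.
  · obtain ⟨g, hg, hgM⟩ := exists_continuousOn_of_periodic hr
      (M := fun c => L c * Complex.exp (c.1 / 2)) (hL.mul (by fun_prop)) fun c hc => by
        dsimp only
        rw [show L (c.1 + 2 * Real.pi * Complex.I, c.2) = -L c from h hc,
          show (c.1 + 2 * Real.pi * Complex.I) / 2 = c.1 / 2 + Real.pi * Complex.I by ring,
          Complex.exp_add, Complex.exp_pi_mul_I]
        ring
    refine ⟨g, hg, Or.inr fun c hc => ?_⟩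
    obtain ⟨d, rfl⟩ := exists_exp_eq hc.2
    rw [exp_mem_puncturedCylinder hr] at hc
    rw [hgM d hc, mul_pow, hL2 d hc, ← Complex.exp_nat_mul, mul_comm]
    congr 2
    push_cast
    ring

/-- A function that is the complex coordinate of a chart has no square root off its zero set
near a zero. -/
theorem not_exists_sqrt_of_chart {X : Type*} [TopologicalSpace X] {F : X → ℂ}
    (ψ : OpenPartialHomeomorph X (ℂ × ℝ)) (hψ : ∀ x ∈ ψ.source, (ψ x).1 = F x) {x : X}
    (hx : x ∈ ψ.source) (hFx : F x = 0) {U : Set X} (hU : U ∈ 𝓝 x) :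
    ¬∃ g : X → ℂ, ContinuousOn g {x ∈ U | F x ≠ 0} ∧ ∀ x ∈ U, F x ≠ 0 → g x ^ 2 = F x := by
  rintro ⟨g, hg, hg2⟩
  have hx0 : ψ x = (0, (ψ x).2) := Prod.ext ((hψ x hx).trans hFx) rfl
  set s := (ψ x).2
  have hN : ψ.target ∩ ψ.symm ⁻¹' U ∈ 𝓝 ((0 : ℂ), s) := by
    rw [← hx0]
    refine Filter.inter_mem (ψ.open_target.mem_nhds (ψ.map_source hx)) ?_
    refine (ψ.continuousAt_symm (ψ.map_source hx)) ?_
    rwa [ψ.left_inv hx]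
  obtain ⟨ρ, hρ, hsub⟩ := exists_cylinder_subset hN
  -- A small circle around the axis: along it a root `g` equals `±b`, the half-angle root below,
  -- with constant sign. After one turn the circle closes while `b` changes sign.
  let e : ℝ → ℂ := fun θ => ((ρ / 2 : ℝ) : ℂ) * Complex.exp (θ * Complex.I)
  have hρ2 : (0 : ℝ) < ρ / 2 := by positivity
  have hnorm : ∀ θ, ‖e θ‖ = ρ / 2 := fun θ => by
    simp only [e]
    rw [norm_mul, Complex.norm_exp_ofReal_mul_I, mul_one, Complex.norm_real, Real.norm_eq_abs,
      abs_of_pos hρ2]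
  have hmem : ∀ θ, (e θ, s) ∈ ψ.target ∩ ψ.symm ⁻¹' U := fun θ =>
    hsub ρ ρ le_rfl le_rfl ⟨by rw [hnorm]; linarith, by simpa using hρ⟩
  have hF : ∀ θ, F (ψ.symm (e θ, s)) = e θ := fun θ => by
    rw [← hψ _ (ψ.map_target (hmem θ).1), ψ.right_inv (hmem θ).1]
  have he0 : ∀ θ, e θ ≠ 0 := fun θ h => by
    have := hnorm θ
    rw [h, norm_zero] at this
    exact hρ2.ne this
  have hec : Continuous e := by fun_prop
  have hγ : Continuous fun θ => ψ.symm (e θ, s) :=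
    ψ.continuousOn_symm.comp_continuous (by fun_prop) fun θ => (hmem θ).1
  have hG : Continuous fun θ => g (ψ.symm (e θ, s)) :=
    hg.comp_continuous hγ fun θ => ⟨(hmem θ).2, by rw [hF]; exact he0 θ⟩
  obtain ⟨r, hr⟩ := IsAlgClosed.exists_pow_nat_eq ((ρ / 2 : ℝ) : ℂ) (n := 2) (by norm_num)
  have hr0 : r ≠ 0 := by
    rintro rfl
    rw [zero_pow two_ne_zero] at hr
    exact hρ2.ne (by exact_mod_cast hr)
  let b : ℝ → ℂ := fun θ => r * Complex.exp (θ / 2 * Complex.I)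
  have hb0 : ∀ θ, b θ ≠ 0 := fun θ => mul_ne_zero hr0 (Complex.exp_ne_zero _)
  have hend : e (2 * Real.pi) = e 0 := by
    simp only [e]
    push_cast
    rw [Complex.exp_two_pi_mul_I, zero_mul, Complex.exp_zero]
  have hbend : b (2 * Real.pi) = -b 0 := by
    simp only [b]
    push_cast
    rw [mul_div_cancel_left₀ _ (two_ne_zero), Complex.exp_pi_mul_I]
    simp
  have hsq : ∀ θ, g (ψ.symm (e θ, s)) ^ 2 = b θ ^ 2 := fun θ => by
    rw [hg2 _ (hmem θ).2 (by rw [hF]; exact he0 θ), hF]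
    simp only [e, b]
    rw [mul_pow, hr, ← Complex.exp_nat_mul]
    congr 2
    push_cast
    ring
  rcases isPreconnected_univ.eq_or_eq_neg_of_sq_eq hG.continuousOn
    (show Continuous b by fun_prop).continuousOn (fun θ _ => hsq θ)
    (fun {θ} _ => hb0 θ) with h | h
  · have h1 := h (Set.mem_univ (2 * Real.pi))
    have h2 := h (Set.mem_univ 0)
    simp only [hend] at h1 h2
    rw [hbend, h2] at h1
    exact hb0 0 (self_eq_neg.1 h1)
  · have h1 := h (Set.mem_univ (2 * Real.pi))
    have h2 := h (Set.mem_univ 0)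
    simp only [hend, Pi.neg_apply] at h1 h2
    rw [hbend, h2, neg_neg] at h1
    exact hb0 0 (self_eq_neg.1 h1.symm)

end SquareRoots

/-! ### Square roots on double branched covers -/

section BranchedSquareRoots

open Topology

variable {Y : Type*} [TopologicalSpace Y] {π : Y → sphere3} {K : Set sphere3}

theorem HasLocalForm.fst_eq_zero {φ : OpenPartialHomeomorph Y (ℂ × ℝ)}
    {ψ : OpenPartialHomeomorph sphere3 (ℂ × ℝ)} {y₀ y : Y} (h : HasLocalForm π squareFold φ ψ y₀)
    (hK : IsFlatChart K ψ) (hy : y ∈ φ.source) : π y ∈ K ↔ (φ y).1 = 0 := by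
  rw [hK _ (h.2.1 hy), h.2.2 y hy, squareFold, sq_eq_zero_iff]

/-- Near a branch point the cover is the standard one over a cylinder. -/
theorem IsDoubleBranchedCover.exists_cylinder (h : IsDoubleBranchedCover π K)
    {φ : OpenPartialHomeomorph Y (ℂ × ℝ)} {ψ : OpenPartialHomeomorph sphere3 (ℂ × ℝ)} {y₀ : Y}
    (hφψ : HasLocalForm π squareFold φ ψ y₀) (hK : IsFlatChart K ψ) (hy₀ : π y₀ ∈ K)
    {O : Set Y} (hO : O ∈ 𝓝 y₀) : ∃ ρ > 0,
      cylinder ρ ρ (φ y₀).2 ⊆ φ.target ∧ cylinder (ρ ^ 2) ρ (φ y₀).2 ⊆ ψ.target ∧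
      ∀ y, π y ∈ ψ.source → ψ (π y) ∈ cylinder (ρ ^ 2) ρ (φ y₀).2 → y ∈ φ.source ∧ y ∈ O := by
  have h1 : φ y₀ = (0, (φ y₀).2) := Prod.ext ((hφψ.fst_eq_zero hK hφψ.1).1 hy₀) rfl
  have h2 : ψ (π y₀) = (0, (φ y₀).2) := by
    rw [hφψ.2.2 y₀ hφψ.1, squareFold, h1]
    simp
  set s := (φ y₀).2
  have hN : φ.target ∩ φ.symm ⁻¹' O ∈ 𝓝 ((0 : ℂ), s) := by
    rw [← h1]
    refine Filter.inter_mem (φ.open_target.mem_nhds (φ.map_source hφψ.1)) ?_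
    refine (φ.continuousAt_symm (φ.map_source hφψ.1)) ?_
    rwa [φ.left_inv hφψ.1]
  have hN' : ψ.target ∈ 𝓝 ((0 : ℂ), s) := by
    rw [← h2]
    exact ψ.open_target.mem_nhds (ψ.map_source (hφψ.2.1 hφψ.1))
  obtain ⟨ρ₁, hρ₁, hs₁⟩ := exists_cylinder_subset hN
  obtain ⟨ρ₂, hρ₂, hs₂⟩ := exists_cylinder_subset hN'
  -- The bound by `1` gives `ρ² ≤ ρ`, so the cylinder of radius `ρ²` fits into the target of `ψ`.
  set ρ := min 1 (min ρ₁ ρ₂)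
  have hρ : 0 < ρ := lt_min one_pos (lt_min hρ₁ hρ₂)
  have hρ1 : ρ ≤ 1 := min_le_left _ _
  have hρρ₁ : ρ ≤ ρ₁ := (min_le_right _ _).trans (min_le_left _ _)
  have hρρ₂ : ρ ≤ ρ₂ := (min_le_right _ _).trans (min_le_right _ _)
  have hsub := hs₁ ρ ρ hρρ₁ hρρ₁
  refine ⟨ρ, hρ, fun c hc => (hsub hc).1, hs₂ _ _ ?_ hρρ₂, fun y hy hyc => ?_⟩
  · nlinarith
  -- The roots `w` and `-w` give points of the chart over `π y`. They exhaust the fibre by its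
  -- cardinality, so `y` is one of them.
  obtain ⟨w, hw⟩ := IsAlgClosed.exists_pow_nat_eq (ψ (π y)).1 (n := 2) (by norm_num)
  have hwρ : ‖w‖ < ρ := by
    have := hyc.1
    rw [← hw, norm_pow] at this
    exact lt_of_pow_lt_pow_left₀ 2 hρ.le this
  have hlift : ∀ w', w' ^ 2 = w ^ 2 → φ.symm (w', (ψ (π y)).2) ∈ φ.source ∧
      φ.symm (w', (ψ (π y)).2) ∈ O ∧ π (φ.symm (w', (ψ (π y)).2)) = π y ∧
      φ (φ.symm (w', (ψ (π y)).2)) = (w', (ψ (π y)).2) := by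
    intro w' hw'
    have hn : ‖w'‖ = ‖w‖ := by
      have : ‖w'‖ ^ 2 = ‖w‖ ^ 2 := by rw [← norm_pow, hw', norm_pow]
      exact (sq_eq_sq₀ (norm_nonneg _) (norm_nonneg _)).1 this
    have hm := hsub (show (w', (ψ (π y)).2) ∈ cylinder ρ ρ s from ⟨by rwa [hn], hyc.2⟩)
    have hsrc := φ.map_target hm.1
    refine ⟨hsrc, hm.2, ψ.injOn (hφψ.2.1 hsrc) hy ?_, φ.right_inv hm.1⟩
    rw [hφψ.2.2 _ hsrc, φ.right_inv hm.1, squareFold, hw', hw]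
  obtain ⟨a1, a2, a3, a4⟩ := hlift w rfl
  obtain ⟨b1, b2, b3, b4⟩ := hlift (-w) (by ring)
  set y₁ := φ.symm (w, (ψ (π y)).2)
  set y₂ := φ.symm (-w, (ψ (π y)).2)
  by_cases hyK : π y ∈ K
  · have : y = y₁ := (h.one_over_branch _ hyK).unique rfl a3
    exact this ▸ ⟨a1, a2⟩
  · have hw0 : w ≠ 0 := by
      rintro rfl
      exact hyK ((hK _ hy).2 (by rw [← hw]; simp))
    have hne : y₁ ≠ y₂ := by
      intro heq
      rw [heq, b4] at a4
      exact hw0 (self_eq_neg.1 (congrArg Prod.fst a4).symm)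
    have hfib : ({y₁, y₂} : Set Y) = π ⁻¹' {π y} := by
      have h2s := h.two_sheeted _ hyK
      refine Set.eq_of_subset_of_ncard_le ?_ ?_ (Set.finite_of_ncard_ne_zero (by rw [h2s]; simp))
      · rintro z (rfl | rfl)
        exacts [a3, b3]
      · rw [h2s, Set.ncard_pair hne]
    have hy' : y ∈ ({y₁, y₂} : Set Y) := by rw [hfib]; rfl
    rcases hy' with hy' | hy' <;> rw [hy']
    exacts [⟨a1, a2⟩, ⟨b1, b2⟩]

theorem HasLocalForm.preimage_cylinder_mem_nhds {φ : OpenPartialHomeomorph Y (ℂ × ℝ)}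
    {ψ : OpenPartialHomeomorph sphere3 (ℂ × ℝ)} {y₀ : Y} (h : HasLocalForm π squareFold φ ψ y₀)
    (hK : IsFlatChart K ψ) (hy₀ : π y₀ ∈ K) {r₁ r₂ : ℝ} (hr₁ : 0 < r₁) (hr₂ : 0 < r₂) :
    IsOpen (ψ.source ∩ ψ ⁻¹' cylinder r₁ r₂ (φ y₀).2) ∧
      π y₀ ∈ ψ.source ∩ ψ ⁻¹' cylinder r₁ r₂ (φ y₀).2 := by
  refine ⟨ψ.isOpen_inter_preimage (isOpen_cylinder _ _ _), h.2.1 h.1, ?_⟩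
  rw [Set.mem_preimage, h.2.2 y₀ h.1, squareFold, (h.fst_eq_zero hK h.1).1 hy₀]
  simp [cylinder, hr₁, hr₂]

/-- The preimages of the neighbourhoods of a branch point are a neighbourhood basis. -/
theorem IsDoubleBranchedCover.exists_preimage_subset (h : IsDoubleBranchedCover π K) {y₀ : Y}
    (hy₀ : π y₀ ∈ K) {O : Set Y} (hO : O ∈ 𝓝 y₀) :
    ∃ V : Set sphere3, IsOpen V ∧ π y₀ ∈ V ∧ π ⁻¹' V ⊆ O := by
  obtain ⟨φ, ψ, h1, h2⟩ := h.branched y₀ hy₀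
  obtain ⟨ρ, hρ, -, -, h3⟩ := h.exists_cylinder h1 h2 hy₀ hO
  obtain ⟨h4, h5⟩ := h1.preimage_cylinder_mem_nhds h2 hy₀ (pow_pos hρ 2) hρ
  exact ⟨_, h4, h5, fun y hy => (h3 y hy.1 hy.2).2⟩

/-- Provides points near `x` at which roots do not vanish, so that a local sign between two roots is
determined. -/
theorem IsDoubleBranchedCover.exists_mem_of_nhds (h : IsDoubleBranchedCover π K) (x : sphere3)
    {V : Set sphere3} (hV : V ∈ 𝓝 x) : ∃ y, π y ∈ V ∧ π y ∉ K := by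
  by_cases hx : x ∈ K
  · obtain ⟨y₀, rfl, -⟩ := h.one_over_branch x hx
    obtain ⟨φ, ψ, h1, h2⟩ := h.branched y₀ hx
    obtain ⟨ρ, hρ, h3, -, h4⟩ := h.exists_cylinder h1 h2 hx (h.continuous.continuousAt hV)
    have hm : (((ρ / 2 : ℝ) : ℂ), (φ y₀).2) ∈ cylinder ρ ρ (φ y₀).2 := by
      refine ⟨?_, by simpa using hρ⟩
      rw [Complex.norm_real, Real.norm_eq_abs, abs_of_pos (by positivity)]
      linarith
    have hs := φ.map_target (h3 hm)
    have hr := φ.right_inv (h3 hm)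
    refine ⟨φ.symm (((ρ / 2 : ℝ) : ℂ), (φ y₀).2), (h4 _ (h1.2.1 hs) ?_).2, ?_⟩
    · rw [h1.2.2 _ hs, hr, squareFold]
      refine ⟨?_, by simpa using hρ⟩
      rw [norm_pow, Complex.norm_real, Real.norm_eq_abs, abs_of_pos (by positivity)]
      nlinarith
    · rw [h1.fst_eq_zero h2 hs, hr]
      exact Complex.ofReal_ne_zero.2 (by positivity)
  · have h1 := h.two_sheeted x hx
    obtain ⟨y, hy⟩ : (π ⁻¹' {x}).Nonempty := by
      rw [Set.nonempty_iff_ne_empty]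
      intro h2
      rw [h2, Set.ncard_empty] at h1
      exact absurd h1 (by norm_num)
    have hy' : π y = x := hy
    exact ⟨y, by rw [hy']; exact mem_of_mem_nhds hV, by rwa [hy']⟩

/-- `W` is a square root of `F ∘ π` over `U` that separates the sheets. -/
structure IsBranchedRoot (π : Y → sphere3) (F : sphere3 → ℂ) (U : Set sphere3) (W : Y → ℂ) :
    Prop where
  continuousOn : ContinuousOn W (π ⁻¹' U)
  sq_eq : ∀ y, π y ∈ U → W y ^ 2 = F (π y)
  injOn : ∀ y y', π y ∈ U → π y = π y' → W y = W y' → y = y'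

variable {F : sphere3 → ℂ}

/-- As `F` has no root near `x` off `K`, the dichotomy on the punctured cylinder gives `g` with `g²
= ψ₁ F`. Upstairs `ψ₁ = φ₁²`, so `g / φ₁` is a root of `F ∘ π`; it separates sheets because `φ₁`
does. -/
theorem IsDoubleBranchedCover.exists_root_branch (h : IsDoubleBranchedCover π K)
    (hF : Continuous F) (hFK : ∀ x, F x = 0 ↔ x ∈ K) {x : sphere3} (hx : x ∈ K)
    (hns : ∀ U ∈ 𝓝 x, ¬∃ g : sphere3 → ℂ, ContinuousOn g {x ∈ U | F x ≠ 0} ∧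
      ∀ x ∈ U, F x ≠ 0 → g x ^ 2 = F x) :
    ∃ U W, IsOpen U ∧ x ∈ U ∧ IsBranchedRoot π F U W := by
  obtain ⟨y₀, rfl, -⟩ := h.one_over_branch x hx
  obtain ⟨φ, ψ, h1, h2⟩ := h.branched y₀ hx
  obtain ⟨ρ, hρ, h3, h4, h5⟩ := h.exists_cylinder h1 h2 hx Filter.univ_mem
  obtain ⟨h6, h7⟩ := h1.preimage_cylinder_mem_nhds h2 hx (pow_pos hρ 2) hρ
  set s := (φ y₀).2
  set U := ψ.source ∩ ψ ⁻¹' cylinder (ρ ^ 2) ρ s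
  have hFU : ∀ x ∈ U, F x ≠ 0 ↔ (ψ x).1 ≠ 0 := fun x hx => by
    rw [Ne, hFK, h2 x hx.1]
  have hsymm : ∀ c ∈ puncturedCylinder (ρ ^ 2) ρ s, F (ψ.symm c) ≠ 0 := by
    intro c hc
    have hs := ψ.map_target (h4 hc.1)
    rw [Ne, hFK, h2 _ hs, ψ.right_inv (h4 hc.1)]
    exact hc.2
  have hmaps : Set.MapsTo ψ {x ∈ U | F x ≠ 0} (puncturedCylinder (ρ ^ 2) ρ s) :=
    fun x hx => ⟨hx.1.2, (hFU x hx.1).1 hx.2⟩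
  obtain ⟨g, hg, hg2⟩ := exists_sqrt_puncturedCylinder (pow_pos hρ 2)
    (f := fun c => F (ψ.symm c))
    (hF.comp_continuousOn (ψ.continuousOn_symm.mono fun c hc => h4 hc.1)) hsymm
  have hgψ : ContinuousOn (fun x => g (ψ x)) {x ∈ U | F x ≠ 0} :=
    hg.comp (ψ.continuousOn.mono fun x hx => hx.1.1) hmaps
  rcases hg2 with hg2 | hg2
  · refine (hns U (h6.mem_nhds h7) ⟨fun x => g (ψ x), hgψ, fun x hx hx0 => ?_⟩).elim
    rw [hg2 _ (hmaps ⟨hx, hx0⟩), ψ.left_inv hx.1]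
  have hsrc : ∀ y, π y ∈ U → y ∈ φ.source := fun y hy => (h5 y hy.1 hy.2).1
  have hW2 : ∀ y, π y ∈ U → (g (ψ (π y)) / (φ y).1) ^ 2 = F (π y) := by
    intro y hy
    have hy1 := hsrc y hy
    by_cases hyK : π y ∈ K
    · rw [(h1.fst_eq_zero h2 hy1).1 hyK, (hFK _).2 hyK]
      simp
    · have h0 : (φ y).1 ≠ 0 := by rwa [Ne, ← h1.fst_eq_zero h2 hy1]
      rw [div_pow, hg2 _ (hmaps ⟨hy, by rwa [Ne, hFK]⟩), ψ.left_inv hy.1, h1.2.2 y hy1, squareFold]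
      field_simp
  refine ⟨U, fun y => g (ψ (π y)) / (φ y).1, h6, h7, ⟨fun y hy => ?_, hW2, fun y y' hy hyy' hW => ?_⟩⟩
  · refine ContinuousAt.continuousWithinAt ?_
    have hy' : π y ∈ U := hy
    have hy1 := hsrc y hy
    by_cases hyK : π y ∈ K
    · have h0 := (h1.fst_eq_zero h2 hy1).1 hyK
      -- Division by zero makes the root vanish over `K`, the right value: its norm is `√|F ∘ π|`,
      -- which tends to zero there.
      rw [ContinuousAt, h0, div_zero, tendsto_zero_iff_norm_tendsto_zero]
      have ht : Filter.Tendsto (fun y => Real.sqrt ‖F (π y)‖) (𝓝 y) (𝓝 0) := by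
        have hc : Continuous fun y => Real.sqrt ‖F (π y)‖ :=
          Real.continuous_sqrt.comp (hF.comp h.continuous).norm
        have := hc.tendsto y
        rwa [(hFK _).2 hyK, norm_zero, Real.sqrt_zero] at this
      refine ht.congr' ?_
      filter_upwards [h.continuous.continuousAt (h6.mem_nhds hy')] with z hz
      rw [← hW2 z hz, norm_pow, Real.sqrt_sq (norm_nonneg _)]
    · have h0 : (φ y).1 ≠ 0 := by rwa [Ne, ← h1.fst_eq_zero h2 hy1]
      have hopen : IsOpen {x ∈ U | F x ≠ 0} := h6.inter (isOpen_ne_fun hF continuous_const)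
      have hc1 : ContinuousAt (fun y => g (ψ (π y))) y :=
        ContinuousAt.comp (f := π) (g := fun x => g (ψ x))
          (hgψ.continuousAt (hopen.mem_nhds ⟨hy', by rwa [Ne, hFK]⟩)) h.continuous.continuousAt
      exact hc1.div (continuousAt_fst.comp (φ.continuousAt hy1)) h0
  · have hy1 := hsrc y hy
    have hy1' := hsrc y' (by rw [← hyy']; exact hy)
    have hψ : squareFold (φ y) = squareFold (φ y') := by
      rw [← h1.2.2 y hy1, ← h1.2.2 y' hy1', hyy']
    by_cases hyK : π y ∈ K
    · exact (h.one_over_branch _ hyK).unique rfl hyy'.symm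
    have h0 : (φ y).1 ≠ 0 := by rwa [Ne, ← h1.fst_eq_zero h2 hy1]
    have hg0 : g (ψ (π y)) ≠ 0 := by
      intro hg0
      have := hW2 y hy
      rw [hg0, zero_div, zero_pow two_ne_zero] at this
      exact hyK ((hFK _).1 this.symm)
    rw [← hyy', div_eq_mul_inv, div_eq_mul_inv] at hW
    have h1' := inv_injective (mul_left_cancel₀ hg0 hW)
    exact φ.injOn hy1 hy1' (Prod.ext h1'
      (congrArg Prod.snd hψ : (squareFold (φ y)).2 = (squareFold (φ y')).2))

/-- Over an evenly covered neighbourhood, a local root of `F` is multiplied by `1` on one sheet and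
`-1` on the other. -/
theorem IsDoubleBranchedCover.exists_root_unbranched (h : IsDoubleBranchedCover π K)
    (hF : Continuous F) {x : sphere3} (hx : x ∉ K) (hFx : F x ≠ 0) :
    ∃ U W, IsOpen U ∧ x ∈ U ∧ IsBranchedRoot π F U W := by
  classical
  obtain ⟨hdisc, U, hxU, hU, -, H, hH⟩ := h.covering x hx
  obtain ⟨y₁, y₂, -, hfib⟩ := Set.ncard_eq_two.1 (h.two_sheeted x hx)
  let sgn : π ⁻¹' {x} → ℂ := fun i => if (i : Y) = y₁ then 1 else -1
  have hsgn2 : ∀ i, sgn i ^ 2 = 1 := fun i => by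
    by_cases hi : (i : Y) = y₁ <;> simp [sgn, hi]
  have hsgn : Function.Injective sgn := by
    intro i j hij
    have key : ∀ k : π ⁻¹' {x}, (k : Y) ≠ y₁ → (k : Y) = y₂ := fun k hk =>
      (hfib ▸ k.2 : (k : Y) ∈ ({y₁, y₂} : Set Y)).resolve_left hk
    ext
    by_cases hi : (i : Y) = y₁ <;> by_cases hj : (j : Y) = y₁
    · rw [hi, hj]
    · simp only [sgn, hi, hj, if_true, if_false] at hij
      norm_num at hij
    · simp only [sgn, hi, hj, if_true, if_false] at hij
      norm_num at hij
    · rw [key i hi, key j hj]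
  obtain ⟨r₀, hr₀⟩ := IsAlgClosed.exists_pow_nat_eq (F x) (n := 2) (by norm_num)
  -- Dividing by `F x` moves the value at `x` to `1`, where the principal root is continuous.
  let r : sphere3 → ℂ := fun x' => r₀ * (F x' / F x) ^ ((2 : ℕ) : ℂ)⁻¹
  have hr2 : ∀ x', r x' ^ 2 = F x' := fun x' => by
    simp only [r]
    rw [mul_pow, hr₀, Complex.cpow_nat_inv_pow _ two_ne_zero, mul_div_cancel₀ _ hFx]
  let V : Set sphere3 := U ∩ {x' | F x' / F x ∈ Complex.slitPlane}
  have hV : IsOpen V := hU.inter (Complex.isOpen_slitPlane.preimage (hF.div_const _))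
  have hrV : ContinuousOn r V := by
    refine continuousOn_const.mul fun x' hx' => ContinuousAt.continuousWithinAt ?_
    exact ContinuousAt.cpow (hF.div_const (F x)).continuousAt continuousAt_const hx'.2
  let W : Y → ℂ := fun y => if hy : y ∈ π ⁻¹' U then sgn (H ⟨y, hy⟩).2 * r (π y) else 0
  have hW : ∀ y (hy : y ∈ π ⁻¹' U), W y = sgn (H ⟨y, hy⟩).2 * r (π y) := fun y hy => dif_pos hy
  refine ⟨V, W, hV, ⟨hxU, ?_⟩, ⟨?_, fun y hy => ?_, fun y y' hy hyy' hWW => ?_⟩⟩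
  · change F x / F x ∈ Complex.slitPlane
    rw [div_self hFx]
    exact Complex.one_mem_slitPlane
  · rw [continuousOn_iff_continuous_domRestrict]
    have hc1 : Continuous fun y : π ⁻¹' V => sgn (H ⟨y, y.2.1⟩).2 := by
      have hs : Continuous sgn := continuous_of_discreteTopology
      exact hs.comp (continuous_snd.comp (H.continuous.comp (continuous_subtype_val.subtype_mk _)))
    have hc2 : Continuous fun y : π ⁻¹' V => r (π y) :=
      hrV.comp_continuous (h.continuous.comp continuous_subtype_val) fun y => y.2
    exact (hc1.mul hc2).congr fun y => (hW y y.2.1).symm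
  · rw [hW y hy.1, mul_pow, hsgn2, hr2, one_mul]
  · have hyU : y ∈ π ⁻¹' U := hy.1
    have hyU' : y' ∈ π ⁻¹' U := by rw [Set.mem_preimage, ← hyy']; exact hy.1
    have hr0 : r (π y) ≠ 0 := by
      intro h0
      have h1 := hr2 (π y)
      rw [h0, zero_pow two_ne_zero] at h1
      have h2 : F (π y) / F x ∈ Complex.slitPlane := hy.2
      rw [← h1, zero_div] at h2
      exact Complex.zero_notMem_slitPlane h2
    rw [hW y hyU, hW y' hyU', ← hyy'] at hWW
    have h1 := hsgn (mul_right_cancel₀ hr0 hWW)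
    have h2 : (H ⟨y, hyU⟩).1 = (H ⟨y', hyU'⟩).1 := by
      ext1
      rw [hH, hH]
      exact hyy'
    exact congrArg Subtype.val (H.injective (Prod.ext h2 h1))

theorem IsBranchedRoot.eq_or_eq_neg {U : Set sphere3} {W W' : Y → ℂ} (hW : IsBranchedRoot π F U W)
    (hW' : IsBranchedRoot π F U W') {y : Y} (hy : π y ∈ U) : W' y = W y ∨ W' y = -W y := by
  rw [← sq_eq_sq_iff_eq_or_eq_neg, hW.sq_eq y hy, hW'.sq_eq y hy]

theorem IsBranchedRoot.mono {U V : Set sphere3} {W : Y → ℂ} (hW : IsBranchedRoot π F U W)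
    (h : V ⊆ U) : IsBranchedRoot π F V W :=
  ⟨hW.continuousOn.mono fun _ hy => h hy, fun y hy => hW.sq_eq y (h hy),
    fun y y' hy => hW.injOn y y' (h hy)⟩

theorem IsBranchedRoot.eq_neg {U : Set sphere3} {W : Y → ℂ} (hW : IsBranchedRoot π F U W)
    {y y' : Y} (hy : π y ∈ U) (hyy' : π y = π y') (hne : y ≠ y') : W y' = -W y := by
  have h1 : W y' ^ 2 = W y ^ 2 := by rw [hW.sq_eq y hy, hW.sq_eq y' (hyy' ▸ hy), hyy']
  exact (sq_eq_sq_iff_eq_or_eq_neg.1 h1).resolve_left fun h => hne (hW.injOn y y' hy hyy' h.symm)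

/-- Two square roots over `U` agree up to sign near every point of `U`. -/
theorem IsDoubleBranchedCover.exists_sign (h : IsDoubleBranchedCover π K)
    (hFK : ∀ x, F x = 0 ↔ x ∈ K) {U : Set sphere3} (hU : IsOpen U)
    {W W' : Y → ℂ} (hW : IsBranchedRoot π F U W) (hW' : IsBranchedRoot π F U W') {x : sphere3}
    (hx : x ∈ U) : ∃ ε : ℤˣ, ∀ᶠ x' in 𝓝 x, ∀ y, π y = x' → W' y = ((ε : ℤ) : ℂ) * W y := by
  suffices hs : (∀ᶠ x' in 𝓝 x, ∀ y, π y = x' → W' y = W y) ∨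
      ∀ᶠ x' in 𝓝 x, ∀ y, π y = x' → W' y = -W y by
    rcases hs with hs | hs
    · exact ⟨1, by simpa using hs⟩
    · exact ⟨-1, by simpa using hs⟩
  by_cases hxK : x ∈ K
  · obtain ⟨y₀, rfl, -⟩ := h.one_over_branch x hxK
    obtain ⟨φ, ψ, h1, h2⟩ := h.branched y₀ hxK
    obtain ⟨ρ, hρ, h3, -, h5⟩ := h.exists_cylinder h1 h2 hxK
      (h.continuous.continuousAt (hU.mem_nhds hx))
    obtain ⟨h6, h7⟩ := h1.preimage_cylinder_mem_nhds h2 hxK (pow_pos hρ 2) hρ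
    set s := (φ y₀).2
    have hmaps : Set.MapsTo φ.symm (puncturedCylinder ρ ρ s) (π ⁻¹' U) := by
      intro c hc
      have hs := φ.map_target (h3 hc.1)
      refine (h5 _ (h1.2.1 hs) ?_).2
      rw [h1.2.2 _ hs, φ.right_inv (h3 hc.1), squareFold]
      refine ⟨?_, hc.1.2⟩
      rw [norm_pow]
      exact pow_lt_pow_left₀ hc.1.1 (norm_nonneg _) two_ne_zero
    have hcont : ContinuousOn φ.symm (puncturedCylinder ρ ρ s) :=
      φ.continuousOn_symm.mono fun c hc => h3 hc.1
    have hmem : ∀ y, π y ∈ ψ.source ∩ ψ ⁻¹' cylinder (ρ ^ 2) ρ s → π y ∉ K →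
        φ y ∈ puncturedCylinder ρ ρ s ∧ φ.symm (φ y) = y := by
      intro y hy hyK
      have hs := (h5 y hy.1 hy.2).1
      have hc : ψ (π y) ∈ cylinder (ρ ^ 2) ρ s := hy.2
      rw [h1.2.2 y hs, squareFold] at hc
      refine ⟨⟨⟨?_, hc.2⟩, by rwa [Ne, ← h1.fst_eq_zero h2 hs]⟩, φ.left_inv hs⟩
      have := hc.1
      rw [norm_pow] at this
      exact lt_of_pow_lt_pow_left₀ 2 hρ.le this
    have hK0 : ∀ y, π y ∈ ψ.source ∩ ψ ⁻¹' cylinder (ρ ^ 2) ρ s → π y ∈ K →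
        W' y = 0 ∧ W y = 0 := by
      intro y hy hyK
      have hyU : π y ∈ U := (h5 y hy.1 hy.2).2
      rw [← sq_eq_zero_iff, hW'.sq_eq y hyU, ← sq_eq_zero_iff (a := W y), hW.sq_eq y hyU, hFK]
      exact ⟨hyK, hyK⟩
    -- At a branch point one sign serves a whole neighbourhood, since the punctured cylinder
    -- upstairs is connected.
    rcases (isPreconnected_puncturedCylinder hρ ρ s).eq_or_eq_neg_of_sq_eq
      (f := fun c => W' (φ.symm c)) (g := fun c => W (φ.symm c))
      (hW'.continuousOn.comp hcont hmaps) (hW.continuousOn.comp hcont hmaps)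
      (fun c hc => by
        simp only [Pi.pow_apply]
        rw [hW'.sq_eq _ (hmaps hc), hW.sq_eq _ (hmaps hc)])
      (fun {c} hc h0 => by
        have hsq := hW.sq_eq _ (hmaps hc)
        rw [h0, zero_pow two_ne_zero, eq_comm, hFK,
          h1.fst_eq_zero h2 (φ.map_target (h3 hc.1)), φ.right_inv (h3 hc.1)] at hsq
        exact hc.2 hsq) with heq | heq
    · left
      filter_upwards [h6.mem_nhds h7] with x' hx' y hy
      subst hy
      by_cases hyK : π y ∈ K
      · rw [(hK0 y hx' hyK).1, (hK0 y hx' hyK).2]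
      · obtain ⟨hm1, hm2⟩ := hmem y hx' hyK
        simpa only [hm2] using heq hm1
    · right
      filter_upwards [h6.mem_nhds h7] with x' hx' y hy
      subst hy
      by_cases hyK : π y ∈ K
      · rw [(hK0 y hx' hyK).1, (hK0 y hx' hyK).2, neg_zero]
      · obtain ⟨hm1, hm2⟩ := hmem y hx' hyK
        simpa only [hm2, Pi.neg_apply] using heq hm1
  · obtain ⟨y₁, hy₁⟩ : (π ⁻¹' {x}).Nonempty := by
      rw [← Set.ncard_pos (Set.finite_of_ncard_ne_zero (by rw [h.two_sheeted x hxK]; simp)),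
        h.two_sheeted x hxK]
      norm_num
    obtain rfl : π y₁ = x := hy₁
    have hopen : IsOpen (π ⁻¹' U) := hU.preimage h.continuous
    have hc : ContinuousAt W y₁ := hW.continuousOn.continuousAt (hopen.mem_nhds hx)
    have hc' : ContinuousAt W' y₁ := hW'.continuousOn.continuousAt (hopen.mem_nhds hx)
    have hmap := h.covering.isLocalHomeomorphOn.map_nhds_eq (x := y₁) hxK
    have hW0 : W y₁ ≠ 0 := by
      intro h0
      have := hW.sq_eq y₁ hx
      rw [h0, zero_pow two_ne_zero, eq_comm, hFK] at this
      exact hxK this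
    have hne : ∀ᶠ y in 𝓝 y₁, W y ≠ 0 := hc.eventually_ne hW0
    have hUe : ∀ᶠ y in 𝓝 y₁, π y ∈ U := hopen.mem_nhds hx
    -- A relation near one point of the fibre passes to the other sheet, because both roots change
    -- sign there.
    have spread : ∀ ε : ℂ, (∀ᶠ y in 𝓝 y₁, W' y = ε * W y) →
        ∀ᶠ x' in 𝓝 (π y₁), ∀ y, π y = x' → W' y = ε * W y := by
      intro ε hε
      have : π '' {y | W' y = ε * W y ∧ W y ≠ 0 ∧ π y ∈ U} ∈ 𝓝 (π y₁) := by
        rw [← hmap]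
        exact Filter.image_mem_map (hε.and (hne.and hUe))
      filter_upwards [this] with x' hx' y hy
      obtain ⟨z, ⟨hz1, hz2, hz3⟩, rfl⟩ := hx'
      by_cases hzy : z = y
      · rw [← hzy, hz1]
      · rw [hW.eq_neg hz3 hy.symm hzy, hW'.eq_neg hz3 hy.symm hzy, hz1]
        ring
    rcases hW.eq_or_eq_neg hW' hx with h1 | h1
    · left
      have : ∀ᶠ y in 𝓝 y₁, W' y = 1 * W y := by
        have h2 : ∀ᶠ y in 𝓝 y₁, W' y + W y ≠ 0 :=
          (hc'.add hc).eventually_ne (by rw [Pi.add_apply, h1, ← two_mul]; exact mul_ne_zero two_ne_zero hW0)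
        filter_upwards [h2, hUe] with y hy hyU
        rw [one_mul]
        exact (hW.eq_or_eq_neg hW' hyU).resolve_right fun h => hy (by rw [h, neg_add_cancel])
      simpa only [one_mul] using spread 1 this
    · right
      have : ∀ᶠ y in 𝓝 y₁, W' y = -1 * W y := by
        have h2 : ∀ᶠ y in 𝓝 y₁, W' y - W y ≠ 0 :=
          (hc'.sub hc).eventually_ne (by
            rw [Pi.sub_apply, h1, ← neg_add', neg_ne_zero, ← two_mul]; exact mul_ne_zero two_ne_zero hW0)
        filter_upwards [h2, hUe] with y hy hyU
        rw [neg_one_mul]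
        exact (hW.eq_or_eq_neg hW' hyU).resolve_left fun h => hy (by rw [h, sub_self])
      simpa only [neg_one_mul] using spread (-1) this

/-- A function that vanishes exactly on `K` and has no local square roots at `K` has a square
root on every double cover branched along `K`. -/
theorem IsDoubleBranchedCover.exists_root (h : IsDoubleBranchedCover π K)
    (hF : Continuous F) (hFK : ∀ x, F x = 0 ↔ x ∈ K)
    (hns : ∀ x ∈ K, ∀ U ∈ 𝓝 x, ¬∃ g : sphere3 → ℂ, ContinuousOn g {x ∈ U | F x ≠ 0} ∧
      ∀ x ∈ U, F x ≠ 0 → g x ^ 2 = F x) :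
    ∃ W, IsBranchedRoot π F Set.univ W := by
  have hloc : ∀ x, ∃ U W, IsOpen U ∧ x ∈ U ∧ IsBranchedRoot π F U W := fun x => by
    by_cases hx : x ∈ K
    · exact h.exists_root_branch hF hFK hx (hns x hx)
    · exact h.exists_root_unbranched hF hx (by rwa [Ne, hFK])
  choose U W hU hxU hW using hloc
  have hsign : ∀ i j x, x ∈ U i ∩ U j → ∃ ε : ℤˣ, ∀ᶠ x' in 𝓝 x, ∀ y, π y = x' →
      W j y = ((ε : ℤ) : ℂ) * W i y := fun i j x hx =>
    h.exists_sign hFK ((hU i).inter (hU j)) ((hW i).mono Set.inter_subset_left)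
      ((hW j).mono Set.inter_subset_right) hx
  have hself : ∀ i x, x ∈ U i → ∀ ε ε' : ℤˣ, (∀ᶠ x' in 𝓝 x, ∀ y, π y = x' →
      ((ε : ℤ) : ℂ) * W i y = ((ε' : ℤ) : ℂ) * W i y) → ε = ε' := by
    intro i x hx ε ε' hεε'
    obtain ⟨y, hy, hyK⟩ := h.exists_mem_of_nhds x (hεε'.and ((hU i).mem_nhds hx))
    have hW0 : W i y ≠ 0 := by
      intro h0
      have := (hW i).sq_eq y hy.2
      rw [h0, zero_pow two_ne_zero, eq_comm, hFK] at this
      exact hyK this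
    have := mul_right_cancel₀ hW0 (hy.1 y rfl)
    exact Units.ext (by exact_mod_cast this)
  choose! c hc using hsign
  have huniq : ∀ i j x, x ∈ U i ∩ U j → ∀ ε : ℤˣ, (∀ᶠ x' in 𝓝 x, ∀ y, π y = x' →
      W j y = ((ε : ℤ) : ℂ) * W i y) → c i j x = ε := fun i j x hx ε hε =>
    hself i x hx.1 _ _ (by
      filter_upwards [hc i j x hx, hε] with x' h1 h2 y hy
      rw [← h1 y hy, ← h2 y hy])
  -- The transition signs are locally constant and satisfy the cocycle identity because they are
  -- unique. With `s j = c i j * s i`, the functions `s i * W i` agree on overlaps.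
  obtain ⟨s, hs, hs'⟩ := exists_sign_of_cocycle U hU (fun x => x) hxU c
    (fun i j x hx => ContinuousAt.continuousWithinAt (by
      refine (continuousAt_const (y := c i j x)).congr ?_
      filter_upwards [(hc i j x hx).eventually_nhds,
        ((hU i).inter (hU j)).mem_nhds hx] with x' hx' hx''
      exact (huniq i j x' hx'' _ hx').symm))
    (fun i x hx => huniq i i x ⟨hx, hx⟩ 1 (by simp))
    (fun i j k x hx => by
      refine (huniq i k x ⟨hx.1.1, hx.2⟩ _ ?_).symm
      filter_upwards [hc i j x hx.1, hc j k x ⟨hx.1.2, hx.2⟩] with x' h1 h2 y hy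
      rw [h2 y hy, h1 y hy]
      push_cast
      ring)
  have hglue : ∀ i y, π y ∈ U i → ((s (π y) (π y) : ℤ) : ℂ) * W (π y) y =
      ((s i (π y) : ℤ) : ℂ) * W i y := by
    intro i y hy
    have hmem : π y ∈ U i ∩ U (π y) := ⟨hy, hxU _⟩
    rw [hs' i (π y) (π y) hmem, (hc i (π y) (π y) hmem).self_of_nhds y rfl]
    rcases Int.units_eq_one_or (c i (π y) (π y)) with h1 | h1 <;> rw [h1] <;> push_cast <;> ring
  have hs2 : ∀ ε : ℤˣ, ((ε : ℤ) : ℂ) ^ 2 = 1 := fun ε => by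
    rcases Int.units_eq_one_or ε with h1 | h1 <;> rw [h1] <;> norm_num
  refine ⟨fun y => ((s (π y) (π y) : ℤ) : ℂ) * W (π y) y, ⟨fun y _ => ?_, fun y _ => ?_,
    fun y y' _ hyy' hWW => ?_⟩⟩
  · refine ContinuousAt.continuousWithinAt ?_
    have hy : π y ∈ U (π y) := hxU _
    have hnhds : π ⁻¹' U (π y) ∈ 𝓝 y := h.continuous.continuousAt ((hU _).mem_nhds hy)
    have hc1 : ContinuousAt (fun z => ((s (π y) (π z) : ℤ) : ℂ)) y := by
      have hd : Continuous fun ε : ℤˣ => ((ε : ℤ) : ℂ) := continuous_of_discreteTopology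
      exact hd.continuousAt.comp (ContinuousAt.comp (f := π)
        ((hs (π y)).continuousAt ((hU _).mem_nhds hy)) h.continuous.continuousAt)
    refine (hc1.mul ((hW (π y)).continuousOn.continuousAt hnhds)).congr ?_
    filter_upwards [hnhds] with z hz
    exact (hglue (π y) z hz).symm
  · rw [mul_pow, hs2, one_mul, (hW (π y)).sq_eq y (hxU _)]
  · rw [← hyy'] at hWW
    have h0 : ((s (π y) (π y) : ℤ) : ℂ) ≠ 0 := fun h0 => by
      have := hs2 (s (π y) (π y))
      rw [h0] at this
      norm_num at this
    exact (hW (π y)).injOn y y' (hxU _) hyy' (mul_left_cancel₀ h0 hWW)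

end BranchedSquareRoots

/-! ### Classification of the double branched covers of torus knots -/

section Classification

open Topology

variable {p q : ℕ}

/-- The polynomial is the complex coordinate of the knot chart. -/
theorem not_exists_sqrt_torusPoly (hpq : Nat.Coprime p q) (hp : p ≠ 0) (hq : q ≠ 0) (x : sphere3)
    (hx : x ∈ standardTorusKnot p q) (U : Set sphere3) (hU : U ∈ 𝓝 x) :
    ¬∃ g : sphere3 → ℂ, ContinuousOn g {x ∈ U | torusPoly p q x ≠ 0} ∧
      ∀ x ∈ U, torusPoly p q x ≠ 0 → g x ^ 2 = torusPoly p q x := by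
  have hx0 := (mem_standardTorusKnot_iff hpq hp hq x).1 hx
  obtain ⟨ψ, -, hxψ, hψ⟩ := exists_knotChart hp hq x hx0
  exact not_exists_sqrt_of_chart (F := fun x : sphere3 => torusPoly p q x) ψ
    (fun y _ => by rw [hψ y]; rfl) hxψ hx0 hU

/-- Every double cover branched along the standard torus knot is the model cover. -/
theorem IsDoubleBranchedCover.exists_homeomorph_modelCover {Y : Type*} [TopologicalSpace Y]
    {π : Y → sphere3} (hpq : Nat.Coprime p q) (hp : p ≠ 0) (hq : q ≠ 0)
    (h : IsDoubleBranchedCover π (standardTorusKnot p q)) :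
    ∃ e : Y ≃ₜ modelCover p q, ∀ y, modelProj p q (e y) = π y := by
  have hFK : ∀ x : sphere3, torusPoly p q x = 0 ↔ x ∈ standardTorusKnot p q := fun x =>
    (mem_standardTorusKnot_iff hpq hp hq x).symm
  obtain ⟨W, hW⟩ := h.exists_root (F := fun x : sphere3 => torusPoly p q x)
    ((continuous_torusPoly p q).comp continuous_subtype_val) hFK
    (not_exists_sqrt_torusPoly hpq hp hq)
  have hWc : Continuous W := by
    rw [← continuousOn_univ]
    exact hW.continuousOn
  have hW2 : ∀ y, W y ^ 2 = torusPoly p q (π y) := fun y => hW.sq_eq y trivial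
  let E : Y → modelCover p q := fun y => ⟨(W y, (π y).1), (π y).2, hW2 y⟩
  have hE : ∀ y, modelProj p q (E y) = π y := fun y => rfl
  have hEc : Continuous E :=
    (hWc.prodMk (continuous_subtype_val.comp h.continuous)).subtype_mk _
  have hinj : Function.Injective E := fun y y' hyy' =>
    hW.injOn y y' trivial (congrArg (modelProj p q) hyy')
      (congrArg (fun u : modelCover p q => u.1.1) hyy')
  have hsurj : Function.Surjective E := by
    intro m
    by_cases hm : modelProj p q m ∈ standardTorusKnot p q
    · obtain ⟨y, hy, -⟩ := h.one_over_branch _ hm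
      refine ⟨y, ?_⟩
      rcases (modelProj_eq_iff m (E y)).1 hy with h1 | h1
      · exact h1
      · rw [fst_eq_zero_iff_modelProj_mem hpq hp hq] at hm
        rw [hm, neg_zero] at h1
        exact Subtype.ext (h1.trans (Prod.ext hm.symm rfl))
    · obtain ⟨y₁, y₂, hne, hfib⟩ := Set.ncard_eq_two.1 (h.two_sheeted _ hm)
      have hy₁ : π y₁ = modelProj p q m := by
        have : y₁ ∈ π ⁻¹' {modelProj p q m} := by rw [hfib]; exact Or.inl rfl
        exact this
      have hy₂ : π y₂ = modelProj p q m := by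
        have : y₂ ∈ π ⁻¹' {modelProj p q m} := by rw [hfib]; exact Or.inr rfl
        exact this
      rcases (modelProj_eq_iff m (E y₁)).1 hy₁ with h1 | h1
      · exact ⟨y₁, h1⟩
      · refine ⟨y₂, ((modelProj_eq_iff m (E y₂)).1 hy₂).resolve_right fun h2 => hne ?_⟩
        exact hinj (Subtype.ext (h1.trans h2.symm))
  -- `Y` is not known to be compact, so openness is checked directly. Over the knot, preimages of
  -- neighbourhoods form a neighbourhood basis.
  have hopen : IsOpenMap E := by
    rw [isOpenMap_iff_nhds_le]
    intro y S hS
    rw [Filter.mem_map] at hS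
    by_cases hyK : π y ∈ standardTorusKnot p q
    · obtain ⟨V, hV, hyV, hVS⟩ := h.exists_preimage_subset hyK hS
      refine Filter.mem_of_superset ((hV.preimage (continuous_modelProj p q)).mem_nhds hyV) ?_
      intro m hm
      obtain ⟨z, rfl⟩ := hsurj m
      exact hVS hm
    · have hW0 : W y ≠ 0 := by
        intro h0
        have h1 := hW2 y
        rw [h0, zero_pow two_ne_zero, eq_comm, hFK] at h1
        exact hyK h1
      -- Off the knot, the half plane around `W y` singles out one of the two sheets.
      let O : Set Y := {z | E z ∈ S ∧ 0 < (W z / W y).re}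
      have hO : O ∈ 𝓝 y := by
        refine Filter.inter_mem hS ?_
        refine (isOpen_lt continuous_const
          (Complex.continuous_re.comp (hWc.div_const _))).mem_nhds ?_
        simp [hW0]
      have hπO : π '' O ∈ 𝓝 (π y) := by
        rw [← h.covering.isLocalHomeomorphOn.map_nhds_eq (x := y) hyK]
        exact Filter.image_mem_map hO
      have h1 : ∀ᶠ m in 𝓝 (E y), modelProj p q m ∈ π '' O :=
        (continuous_modelProj p q).continuousAt hπO
      have h2 : ∀ᶠ m in 𝓝 (E y), 0 < (m.1.1 / W y).re := by
        have hc : Continuous fun m : modelCover p q => (m.1.1 / W y).re :=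
          Complex.continuous_re.comp
            ((continuous_fst.comp continuous_subtype_val).div_const _)
        refine (isOpen_lt continuous_const hc).mem_nhds ?_
        simp [E, hW0]
      filter_upwards [h1, h2] with m hm1 hm2
      obtain ⟨z, rfl⟩ := hsurj m
      obtain ⟨z', ⟨hz1, hz2⟩, hz3⟩ := hm1
      rcases (modelProj_eq_iff (E z) (E z')).1 hz3 with h3 | h3
      · rw [← h3]
        exact hz1
      · have h4 : W z' = -W z := congrArg Prod.fst h3
        rw [h4, neg_div, Complex.neg_re] at hz2
        have hm2' : 0 < (W z / W y).re := hm2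
        linarith
  exact ⟨(show IsHomeomorph E from ⟨hEc, hopen, hinj, hsurj⟩).homeomorph, hE⟩

end Classification

/-! ### The circle action -/

section CircleAction

variable {p q : ℕ}

/-- The formula of the circle action as a map of the ambient space. -/
def rotationMap (p q : ℕ) (u : ℂ × ℂ × ℂ × ℂ) : ℂ × ℂ × ℂ :=
  (u.1 ^ (p * q) * u.2.1, u.1 ^ (2 * q) * u.2.2.1, u.1 ^ (2 * p) * u.2.2.2)

theorem contDiff_rotationMap (p q : ℕ) : ContDiff ℝ ∞ (rotationMap p q) := by
  unfold rotationMap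
  fun_prop

theorem coe_brieskornRotation (t : Circle) (v : brieskorn 2 p q) :
    (brieskornRotation p q t v : ℂ × ℂ × ℂ) = rotationMap p q (t, v) := rfl

theorem brieskornRotation_one : brieskornRotation p q 1 = id := by
  funext v
  ext1
  simp [coe_brieskornRotation, rotationMap]

theorem brieskornRotation_mul (s t : Circle) :
    brieskornRotation p q (s * t) = brieskornRotation p q s ∘ brieskornRotation p q t := by
  funext v
  ext1
  simp only [Function.comp_apply, coe_brieskornRotation, rotationMap, Circle.coe_mul, mul_pow,
    mul_assoc]

/-- Only the weight of `z` is odd. -/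
theorem brieskornRotation_neg_one (hodd : Odd (p * q)) :
    brieskornRotation p q (-1) = brieskornInvolution p q := by
  funext v
  ext1
  simp [coe_brieskornRotation, rotationMap, brieskornInvolution, hodd.neg_one_pow, pow_mul]

theorem isSmoothMap_brieskornRotation (t : Circle) : IsSmoothMap (brieskornRotation p q t) :=
  .of_contDiff (fun v => rotationMap p q (t, v))
    ((contDiff_rotationMap p q).comp (contDiff_const.prodMk contDiff_id)) fun _ => rfl

theorem brieskornRotation_inv_apply (t : Circle) (v : brieskorn 2 p q) :
    brieskornRotation p q t⁻¹ (brieskornRotation p q t v) = v := by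
  rw [← Function.comp_apply (f := brieskornRotation p q t⁻¹), ← brieskornRotation_mul,
    inv_mul_cancel, brieskornRotation_one, id]

theorem isDiffeo_brieskornRotation (t : Circle) : IsDiffeo (brieskornRotation p q t) :=
  ⟨isSmoothMap_brieskornRotation t, brieskornRotation p q t⁻¹, isSmoothMap_brieskornRotation _,
    brieskornRotation_inv_apply t, fun v => by
      simpa using brieskornRotation_inv_apply t⁻¹ v⟩

theorem continuous_brieskornRotation :
    Continuous fun u : Circle × brieskorn 2 p q => brieskornRotation p q u.1 u.2 :=
  ((contDiff_rotationMap p q).continuous.comp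
    ((continuous_subtype_val.comp continuous_fst).prodMk
      (continuous_subtype_val.comp continuous_snd))).subtype_mk _

theorem circle_exp_pi : Circle.exp Real.pi = -1 := by
  ext1
  simp [Circle.coe_exp, Complex.exp_pi_mul_I]

theorem isSmoothIsotopy_brieskornRotation (hodd : Odd (p * q)) :
    IsSmoothIsotopy (fun s : ℝ => brieskornRotation p q (Circle.exp (Real.pi * s)))
      id (brieskornInvolution p q) := by
  refine ⟨?_, fun s _ => isDiffeo_brieskornRotation _, ?_, ?_⟩
  · refine .of_contDiff
      (fun u => rotationMap p q (Complex.exp ((Real.pi * u.1 : ℝ) * Complex.I), u.2)) ?_ fun u => ?_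
    · refine (contDiff_rotationMap p q).comp (ContDiff.prodMk ?_ contDiff_snd)
      refine ContDiff.cexp (ContDiff.mul ?_ contDiff_const)
      exact Complex.ofRealCLM.contDiff.comp (contDiff_const.mul contDiff_fst)
    · rw [coe_brieskornRotation, Circle.coe_exp]
  · simp only [mul_zero, Circle.exp_zero, brieskornRotation_one]
  · simp only [mul_one, circle_exp_pi, brieskornRotation_neg_one hodd]

end CircleAction

/-! ### Transfer of the classification and the isotopy to arbitrary covers -/

section CoveringInvolutions

/-- A homeomorphism over the base intertwines covering involutions. -/
theorem IsCoveringInvolution.map_eq {X Y Y' : Type*} {π : Y → X} {π' : Y' → X} {τ : Y → Y}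
    {τ' : Y' → Y'} (hτ : IsCoveringInvolution π τ) (hτ' : IsCoveringInvolution π' τ') (h : Y ≃ Y')
    (hπ : ∀ y, π' (h y) = π y) (y : Y) : h (τ y) = τ' (h y) := by
  have h1 : π (τ y) = π y := (hτ y (τ y)).2 (Or.inr rfl)
  have h2 : π' (h (τ y)) = π' (h y) := by rw [hπ, hπ, h1]
  -- In the first case `τ` fixes `y`, so its fibre is a single point and `τ'` fixes `h y`.
  rcases (hτ' (h y) (h (τ y))).1 h2 with h3 | h3
  · have h4 : π (h.symm (τ' (h y))) = π y := by
      rw [← hπ, h.apply_symm_apply, ← hπ y]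
      exact (hτ' (h y) _).2 (Or.inr rfl)
    rcases (hτ y _).1 h4 with h5 | h5
    · rw [h3]
      exact (h.symm_apply_eq.1 h5).symm
    · exact (h.symm_apply_eq.1 h5).symm
  · exact h3

theorem isIsotopic_of_homeomorph_brieskorn {p q : ℕ} (hodd : Odd (p * q)) {Y : Type*}
    [TopologicalSpace Y] (h : Y ≃ₜ brieskorn 2 p q) {τ : Y → Y}
    (hτ : ∀ y, h (τ y) = brieskornInvolution p q (h y)) : IsIsotopic τ id := by
  -- The rotation is conjugated by `h`; the parameter `1 - s` makes the path start at `τ`.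
  refine ⟨fun u => h.symm (brieskornRotation p q (Circle.exp (Real.pi * (1 - u.1))) (h u.2)),
    ?_, fun s => ?_, fun y => ?_, fun y => ?_⟩
  · refine h.symm.continuous.comp (continuous_brieskornRotation.comp
      (f := fun u : unitInterval × Y => (Circle.exp (Real.pi * (1 - u.1)), h u.2)) ?_)
    exact (Circle.exp.continuous.comp (by fun_prop)).prodMk (h.continuous.comp continuous_snd)
  · obtain ⟨e, he, -⟩ := (isDiffeo_brieskornRotation (p := p) (q := q)
      (Circle.exp (Real.pi * (1 - s)))).exists_homeomorph
    have := ((h.trans e).trans h.symm).isHomeomorph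
    convert this using 1
    funext y
    simp [he]
  · rw [h.symm_apply_eq, hτ]
    simp [circle_exp_pi, brieskornRotation_neg_one hodd]
  · simp [brieskornRotation_one]

end CoveringInvolutions

/-- Composing with `Φ⁻¹` reduces to the standard knot, where every cover is the model cover. -/
theorem IsDoubleBranchedCover.exists_homeomorph_brieskorn {p q : ℕ} (hpq : p.Coprime q)
    (hp : p ≠ 0) (hq : q ≠ 0) {Y : Type*} [TopologicalSpace Y] {πY : Y → sphere3}
    (Φ : sphere3 ≃ₜ sphere3) (e : brieskorn 2 p q ≃ₜ modelCover p q)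
    (h : IsDoubleBranchedCover πY (Φ '' standardTorusKnot p q)) :
    ∃ h : Y ≃ₜ brieskorn 2 p q, ∀ y, (Φ ∘ modelProj p q ∘ e) (h y) = πY y := by
  have h' := h.transport (Homeomorph.refl Y) Φ.symm
  rw [← Set.image_comp, Φ.symm_comp_self, Set.image_id] at h'
  obtain ⟨f, hf⟩ := h'.exists_homeomorph_modelCover hpq hp hq
  exact ⟨f.trans e.symm, fun y => by simp [hf]⟩

theorem mainTheorem11 (p q : ℕ) (hpq : Nat.Coprime p q) (hodd : Odd (p * q))
    (K : Set sphere3) (hK : IsTorusKnot p q K) :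
    -- `Σ(2,p,q)` with `(z,x,y) ↦ (-z,x,y)` is the double branched cover of `K`
    (∃ π : brieskorn 2 p q → sphere3,
      IsSmoothDoubleBranchedCover π K ∧
      IsCoveringInvolution π (brieskornInvolution p q) ∧
      ∀ (Y : Type*) [TopologicalSpace Y] (πY : Y → sphere3), IsDoubleBranchedCover πY K →
        ∃ h : Y ≃ₜ brieskorn 2 p q, ∀ y, π (h y) = πY y) ∧
    -- the formula is a smooth circle action by diffeomorphisms
    brieskornRotation p q 1 = id ∧
    (∀ s t : Circle,
      brieskornRotation p q (s * t) = brieskornRotation p q s ∘ brieskornRotation p q t) ∧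
    IsSmoothMap (A := Metric.sphere (0 : ℂ) 1 ×ˢ brieskorn 2 p q) (B := brieskorn 2 p q)
      (fun u => brieskornRotation p q ⟨u.1.1, u.2.1⟩ ⟨u.1.2, u.2.2⟩) ∧
    (∀ t : Circle, IsDiffeo (brieskornRotation p q t)) ∧
    brieskornRotation p q (-1) = brieskornInvolution p q ∧
    -- its half `t = exp (π i s)` is a smooth isotopy from the identity to the involution
    IsSmoothIsotopy (fun s : ℝ => brieskornRotation p q (Circle.exp (Real.pi * s)))
      id (brieskornInvolution p q) ∧
    -- the covering involution of every double branched cover of `K` is isotopic to the identity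
    ∀ (Y : Type*) [TopologicalSpace Y] (πY : Y → sphere3) (τ : Y → Y),
      IsDoubleBranchedCover πY K → IsCoveringInvolution πY τ → IsIsotopic τ id := by
  have hpo : Odd p := (Nat.odd_mul.1 hodd).1
  have hqo : Odd q := (Nat.odd_mul.1 hodd).2
  have hp : p ≠ 0 := hpo.pos.ne'
  have hq : q ≠ 0 := hqo.pos.ne'
  obtain ⟨Φ', hΦ', rfl⟩ := hK
  obtain ⟨Φ, rfl, hΦ, hΦs⟩ := hΦ'.exists_homeomorph
  obtain ⟨e, he, hes, heτ⟩ := exists_diffeo_brieskorn_modelCover hp hq hqo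
  have hτ : IsCoveringInvolution (Φ ∘ modelProj p q ∘ e) (brieskornInvolution p q) := by
    intro v v'
    rw [Function.comp_apply, Function.comp_apply, Function.comp_apply, Function.comp_apply,
      Φ.injective.eq_iff, modelProj_eq_iff, e.injective.eq_iff, ← heτ, ← Subtype.ext_iff,
      e.injective.eq_iff]
  refine ⟨⟨Φ ∘ modelProj p q ∘ e, (isSmoothDoubleBranchedCover_modelProj hpq hp hq).transport
      e he hes Φ hΦ hΦs, hτ, fun Y _ πY h => h.exists_homeomorph_brieskorn hpq hp hq Φ e⟩,
    brieskornRotation_one, brieskornRotation_mul, ?_, isDiffeo_brieskornRotation,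
    brieskornRotation_neg_one hodd, isSmoothIsotopy_brieskornRotation hodd,
    fun Y _ πY τ h hτY => ?_⟩
  · exact .of_contDiff (fun u => rotationMap p q u) (contDiff_rotationMap p q) fun _ => rfl
  · obtain ⟨f, hf⟩ := h.exists_homeomorph_brieskorn hpq hp hq Φ e
    exact isIsotopic_of_homeomorph_brieskorn hodd f (hτY.map_eq hτ f.toEquiv hf)
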